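/- Let $M$ be a Hausdorff, paracompact smooth manifold of dimension $m$ (without boundary), let $n\ge 1$, and let $E\to M$ be an $SU(n)$-vector bundle: a smooth complex vector bundle of rank $n$ with a smooth hermitian metric $h$ and a smooth trivialization of $\bigwedge^n E$, of modulus one on orthonormal frames. Let $\mathfrak A$ be the algebra of smooth sections of $\mathrm{End}(E)$, with the involution $S\mapsto S^*$ given by $h$, and let $\mathrm{Der}(\mathfrak A)$ be its Lie algebra of complex linear derivations, a module over the center $\mathcal Z(\mathfrak A)$. A derivation $\mathcal X$ is real if $(\mathcal X S)^*=\mathcal X(S^*)$ for all $S$. For $\gamma\in\mathfrak A$ let $ad_\gamma=[\gamma,\cdot\,]$. A noncommutative $1$-form is a $\mathcal Z(\mathfrak A)$-linear map $\omega:\mathrm{Der}(\mathfrak A)\to\mathfrak A$; put $(\hat d a)(\mathcal X)=\mathcal X a$ for $a\in\mathfrak A$, $(\hat d\omega)(\mathcal X,\mathcal Y)=\mathcal X\omega(\mathcal Y)-\mathcal Y\omega(\mathcal X)-\omega([\mathcal X,\mathcal Y])$, and $\mathcal L_{\mathcal X}\omega=i_{\mathcal X}\hat d\omega+\hat d(i_{\mathcal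 X}\omega)$. An $SU(n)$-connection $\nabla^E$ is a connection on $E$ compatible with $h$ for which the trivialization of $\bigwedge^nE$ is parallel. A noncommutative $1$-form $\alpha$ is the form of $\nabla^E$ if, for every derivation $\mathcal X$, the trace of $\alpha(\mathcal X)$ vanishes and $\mathcal X S=\nabla_X S-[\alpha(\mathcal X),S]$ for all $S\in\mathfrak A$, where $X$ is the (complex) vector field on $M$ given by the restriction of $\mathcal X$ to $C^\infty(M)\subset\mathfrak A$ and $\nabla$ is the connection induced by $\nabla^E$ on $\mathrm{End}(E)$, extended complex linearly to complex vector fields. 1. The real derivations form a real Lie algebra: they are closed under real linear combinations and brackets. On noncommutative $1$-forms, $\mathcal L_{[\mathcal X,\mathcal Y]}=\mathcal L_{\mathcal X}\mathcal L_{\mathcal Y}-\mathcal L_{\mathcal Y}\mathcal L_{\mathcal X}$, and $\mathcal L_{\mathcal X}\omega$ is real linear in $\mathcal X$ and in $\omega$. 2. Let $\alpha$ be the form of an $SU(n)$-connection and let $\mathcal X$ be a real derivation. Then $(\mathcal L_{\mathcal X}\alpha)(ad_\gamma)=0$ for all traceless $\gamma\in\mathfrak A$, $\mathrm{Tr}\,(\mathcal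 L_{\mathcal X}\alpha)(\mathcal Y)=0$ for all derivations $\mathcal Y$, and $(\mathcal L_{\mathcal X}\alpha)(\mathcal Y)^*+(\mathcal L_{\mathcal X}\alpha)(\mathcal Y)=0$ for all real $\mathcal Y$. Consequently $\alpha'=\alpha+\mathcal L_{\mathcal X}\alpha$ satisfies $\alpha'(ad_\gamma)=-\gamma$ for traceless $\gamma$, $\mathrm{Tr}\,\alpha'(\mathcal Y)=0$ for all $\mathcal Y$, and $\alpha'(\mathcal Y)^*+\alpha'(\mathcal Y)=0$ for all real $\mathcal Y$; moreover $\alpha'$ is the form of a unique $SU(n)$-connection. 3. If $\xi\in\mathfrak A$ is traceless and antihermitian ($\xi^*+\xi=0$), then $ad_\xi$ is real; and every inner derivation that is real equals $ad_\xi$ for a unique traceless antihermitian $\xi$. 4. Let $\xi\in\mathfrak A$ be traceless and antihermitian, and let $\alpha$ be the form of an $SU(n)$-connection $\nabla^E$. Then $\mathcal L_{ad_\xi}\alpha=-\hat d\xi-[\alpha,\xi]$. This is the infinitesimal gauge transformation defined by $\xi$: the sections $U_t=\exp(t\xi)$, $t\in\mathbb R$, belong to the gauge group (fiberwise unitary of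 determinant one), the gauge transforms $U_t\circ\nabla^E\circ U_t^{-1}$ are $SU(n)$-connections which have forms $\alpha_t$, and $\frac{d}{dt}\big|_{t=0}\alpha_t(\mathcal Y)=(\mathcal L_{ad_\xi}\alpha)(\mathcal Y)$ pointwise on $M$ for every derivation $\mathcal Y$. -/

import Mathlib

open scoped Manifold ContDiff Topology
open Bundle

noncomputable section

/-! ### The differential calculus based on derivations, in degrees at most two -/

namespace NC

section Algebra

attribute [local instance 100] LieRing.ofAssociativeRing

variable (A : Type*) [Ring A] [Algebra ℂ A]

/-- The complex linear derivations of an associative unital algebra, with the commutator of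
operators as bracket. -/
def derSubalgebra : LieSubalgebra ℂ (Module.End ℂ A) where
  carrier := {D | ∀ a b, D (a * b) = D a * b + a * D b}
  add_mem' := by
    intro D D' h h' a b
    simp only [Set.mem_ofPred_eq] at h h'
    simp only [LinearMap.add_apply, h, h', add_mul, mul_add]
    abel
  zero_mem' := by intro a b; simp
  smul_mem' := by
    intro c D h a b
    simp only [Set.mem_ofPred_eq] at h
    simp [h]
  lie_mem' := by
    intro D D' h h' a b
    simp only [Set.mem_ofPred_eq] at h h'
    change ∀ a b, D (a * b) = _ at h
    change ∀ a b, D' (a * b) = _ at h'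
    simp only [LieRing.of_associative_ring_bracket, LinearMap.sub_apply, Module.End.mul_apply, h,
      h', map_add, sub_mul, mul_sub]
    abel

/-- The Lie algebra `Der(A)`. -/
def Der : Type _ := derSubalgebra A

instance : LieRing (Der A) := inferInstanceAs (LieRing (derSubalgebra A))

instance : LieAlgebra ℂ (Der A) := inferInstanceAs (LieAlgebra ℂ (derSubalgebra A))

variable {A}

/-- A derivation as a complex linear operator on the algebra. -/
instance : CoeFun (Der A) (fun _ => A → A) := ⟨fun D a => D.1 a⟩

theorem Der.leibniz (D : Der A) (a b : A) : D (a * b) = D a * b + a * D b := D.2 a b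

theorem Der.ext {D D' : Der A} (h : ∀ a, D a = D' a) : D = D' :=
  Subtype.ext (LinearMap.ext h)

theorem center_comm (z : Subalgebra.center ℂ A) (a : A) : (z : A) * a = a * z :=
  (Subalgebra.mem_center_iff.1 z.2 a).symm

/-- Multiplication of a derivation by an element of the center, `(z 𝒳)(a) = z 𝒳(a)`. -/
instance : SMul (Subalgebra.center ℂ A) (Der A) :=
  ⟨fun z D => ⟨LinearMap.mulLeft ℂ (z : A) ∘ₗ D.1, by
    intro a b
    change (z : A) * (D (a * b)) = _
    rw [Der.leibniz, mul_add, ← mul_assoc, ← mul_assoc, center_comm z a, mul_assoc a]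
    rfl⟩⟩

theorem Der.center_smul_apply (z : Subalgebra.center ℂ A) (D : Der A) (a : A) :
    (z • D) a = (z : A) * D a := rfl

theorem Der.add_apply (D D' : Der A) (a : A) : (D + D') a = D a + D' a := rfl

theorem Der.smul_apply (c : ℂ) (D : Der A) (a : A) : (c • D) a = c • D a := rfl

theorem Der.zero_apply (a : A) : (0 : Der A) a = 0 := rfl

theorem Der.neg_apply (D : Der A) (a : A) : (-D) a = -D a := rfl

theorem Der.lie_apply (D D' : Der A) (a : A) : ⁅D, D'⁆ a = D (D' a) - D' (D a) := rfl

theorem Der.map_add (D : Der A) (a b : A) : D (a + b) = D a + D b :=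
  _root_.map_add D.1 a b

theorem Der.map_neg (D : Der A) (a : A) : D (-a) = -D a :=
  _root_.map_neg D.1 a

/-- `Der(A)` as a module over the center of `A`. -/
instance : Module (Subalgebra.center ℂ A) (Der A) where
  one_smul D := Der.ext fun a => by simp [Der.center_smul_apply]
  mul_smul z w D := Der.ext fun a => by simp [Der.center_smul_apply, mul_assoc]
  smul_zero z := Der.ext fun a => by simp [Der.center_smul_apply, Der.zero_apply]
  smul_add z D D' := Der.ext fun a => by
    simp [Der.center_smul_apply, Der.add_apply, mul_add]
  add_smul z w D := Der.ext fun a => by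
    simp [Der.center_smul_apply, Der.add_apply, add_mul]
  zero_smul D := Der.ext fun a => by simp [Der.center_smul_apply, Der.zero_apply]

/-- The inner derivation `ad_γ = [γ, ·]`. -/
def ad (γ : A) : Der A :=
  ⟨LinearMap.mulLeft ℂ γ - LinearMap.mulRight ℂ γ, by
    intro a b
    simp only [LinearMap.sub_apply, LinearMap.mulLeft_apply, LinearMap.mulRight_apply, sub_mul,
      mul_sub, mul_assoc]
    abel⟩

theorem ad_apply (γ a : A) : ad γ a = γ * a - a * γ := rfl

variable (A) in
/-- Noncommutative 1-forms: maps `Der(A) → A`, linear over the center. -/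
abbrev Form1 := Der A →ₗ[Subalgebra.center ℂ A] A

variable (A) in
/-- Maps `Der(A) × Der(A) → A`, bilinear over the center. The noncommutative 2-forms are the
antisymmetric ones. -/
abbrev Bilin := Der A →ₗ[Subalgebra.center ℂ A] Der A →ₗ[Subalgebra.center ℂ A] A

/-- The differential of a 0-form: `(d a)(𝒳) = 𝒳 a`. -/
def d0 (a : A) : Form1 A where
  toFun D := D a
  map_add' _ _ := rfl
  map_smul' _ _ := rfl

theorem Form1.map_center_smul (β : Form1 A) (z : Subalgebra.center ℂ A) (D : Der A) :
    β (z • D) = (z : A) * β D := map_smul β z D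

/-- A derivation maps the center to itself. -/
def Der.onCenter (D : Der A) (z : Subalgebra.center ℂ A) : Subalgebra.center ℂ A :=
  ⟨D (z : A), by
    rw [Subalgebra.mem_center_iff]
    intro b
    have h1 := Der.leibniz D (z : A) b
    rw [center_comm z b, Der.leibniz, center_comm z (D b), add_comm] at h1
    exact add_right_cancel h1⟩

theorem Der.lie_center_smul (D D' : Der A) (z : Subalgebra.center ℂ A) :
    ⁅D, z • D'⁆ = D.onCenter z • D' + z • ⁅D, D'⁆ :=
  Der.ext fun a => by
    simp only [Der.lie_apply, Der.center_smul_apply, Der.add_apply, Der.leibniz, Der.onCenter,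
      mul_sub]
    abel

theorem Der.center_smul_lie (D D' : Der A) (z : Subalgebra.center ℂ A) :
    ⁅z • D, D'⁆ = -(D'.onCenter z • D) + z • ⁅D, D'⁆ := by
  rw [← lie_skew, Der.lie_center_smul, neg_add, ← lie_skew D D', smul_neg]

/-- The differential of a 1-form:
`(d β)(𝒳, 𝒴) = 𝒳 β(𝒴) - 𝒴 β(𝒳) - β([𝒳, 𝒴])`. -/
def d1 (β : Form1 A) : Bilin A :=
  LinearMap.mk₂ (Subalgebra.center ℂ A)
    (fun D D' => D (β D') - D' (β D) - β ⁅D, D'⁆)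
    (by
      intro D₁ D₂ D'
      simp only [Der.add_apply, map_add, add_lie]
      abel)
    (by
      intro z D D'
      simp only [Der.center_smul_apply, Form1.map_center_smul, Der.leibniz, Der.center_smul_lie,
        map_add, map_neg, Der.onCenter]
      rw [Subalgebra.smul_def, smul_eq_mul, mul_sub, mul_sub]
      abel)
    (by
      intro D D₁ D₂
      simp only [Der.add_apply, map_add, lie_add]
      abel)
    (by
      intro z D D'
      simp only [Der.center_smul_apply, Form1.map_center_smul, Der.leibniz, Der.lie_center_smul,
        map_add, Der.onCenter]
      rw [Subalgebra.smul_def, smul_eq_mul, mul_sub, mul_sub]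
      abel)

theorem d1_apply (β : Form1 A) (D D' : Der A) :
    d1 β D D' = D (β D') - D' (β D) - β ⁅D, D'⁆ := rfl

theorem d1_self (β : Form1 A) (D : Der A) : d1 β D D = 0 := by
  simp [d1_apply]

/-- The Lie derivative `L_𝒳 = i_𝒳 d + d i_𝒳` on 1-forms. -/
def lieDeriv (D : Der A) (β : Form1 A) : Form1 A := d1 β D + d0 (β D)

end Algebra

/-! ### `SU(n)`-vector bundles, their endomorphism algebra and their connections -/

section Bundles

variable {m : ℕ} {M : Type*} [TopologicalSpace M] [ChartedSpace (EuclideanSpace ℝ (Fin m)) M]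

variable (m M) in
/-- Smooth vector fields on `M`. -/
abbrev VectorField [IsManifold (𝓡 m) ∞ M] :=
  Cₛ^∞⟮𝓡 m; EuclideanSpace ℝ (Fin m), (TangentSpace (𝓡 m) : M → Type _)⟯

/-- Smooth complex valued functions on `M`. -/
def IsSmooth (f : M → ℂ) : Prop := ContMDiff (𝓡 m) 𝓘(ℝ, ℂ) ∞ f

/-- The derivative `X f` of a complex valued function along a vector field, at a point. -/
def dirDeriv [IsManifold (𝓡 m) ∞ M] (X : VectorField m M) (f : M → ℂ) (x : M) : ℂ :=
  mfderiv (𝓡 m) 𝓘(ℝ, ℂ) f x (X x)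

variable (m) (F : Type*) [NormedAddCommGroup F] [NormedSpace ℂ F]
  (E : M → Type*) [∀ x, AddCommGroup (E x)] [∀ x, Module ℂ (E x)]
  [TopologicalSpace (TotalSpace F E)] [∀ x, TopologicalSpace (E x)] [FiberBundle F E]
  [VectorBundle ℂ F E] [VectorBundle ℝ F E]

/-- Smooth sections of the complex vector bundle `E`. -/
abbrev Sec := Cₛ^∞⟮𝓡 m; F, E⟯

variable {m F E}

/-- The product of a smooth complex valued function and a smooth section. -/
def fsmul (f : M → ℂ) (hf : IsSmooth (m := m) f) (e : Sec m F E) : Sec m F E where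
  toFun x := f x • e x
  contMDiff_toFun := by
    intro x₀
    have he := e.contMDiff x₀
    rw [contMDiffAt_section] at he ⊢
    refine ((contDiff_smul (𝕜 := ℝ)).contMDiff.contMDiffAt.comp x₀
      ((hf x₀).prodMk_space he)).congr_of_eventuallyEq ?_
    filter_upwards [(trivializationAt F E x₀).open_baseSet.mem_nhds
      (FiberBundle.mem_baseSet_trivializationAt' x₀)] with x hx
    exact ((trivializationAt F E x₀).linear ℂ hx).2 (f x) (e x)

variable (m F E) in
/-- The smooth sections of the bundle of complex endomorphisms of `E`: families of
endomorphisms of the fibers, with the fiberwise operations. Smoothness of the family is expressed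
by its mapping smooth sections of `E` to smooth sections of `E`. -/
def endSubalgebra : Subalgebra ℂ (∀ x, Module.End ℂ (E x)) where
  carrier := {S | ∀ e : Sec m F E,
    ContMDiff (𝓡 m) ((𝓡 m).prod 𝓘(ℝ, F)) ∞ (fun x => TotalSpace.mk' F x (S x (e x)))}
  mul_mem' := by
    intro S T hS hT e
    exact hS ⟨fun x => T x (e x), hT e⟩
  add_mem' := by
    intro S T hS hT e
    exact (hS e).add_section (hT e)
  algebraMap_mem' := by
    intro c e
    exact (fsmul (fun _ => c) contMDiff_const e).contMDiff

variable (m F E) in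
/-- The algebra `𝔄` of smooth sections of the endomorphism bundle of `E`. -/
def EndAlg : Type _ := endSubalgebra m F E

instance : Ring (EndAlg m F E) := inferInstanceAs (Ring (endSubalgebra m F E))

instance : Algebra ℂ (EndAlg m F E) := inferInstanceAs (Algebra ℂ (endSubalgebra m F E))

/-- The action of `𝔄` on sections of `E`. -/
def EndAlg.act (S : EndAlg m F E) (e : Sec m F E) : Sec m F E :=
  ⟨fun x => S.1 x (e x), S.2 e⟩

/-- The embedding `f ↦ f 𝟙` of the smooth complex valued functions into `𝔄`. -/
def EndAlg.scalar (f : M → ℂ) (hf : IsSmooth (m := m) f) : EndAlg m F E :=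
  ⟨fun x => f x • (1 : Module.End ℂ (E x)), fun e => (fsmul f hf e).contMDiff⟩

/-- Traceless sections of the endomorphism bundle. -/
def EndAlg.Traceless (S : EndAlg m F E) : Prop :=
  ∀ x, LinearMap.trace ℂ (E x) (S.1 x) = 0

variable (m F E) in
/-- The structure of an `SU(n)`-vector bundle on the complex vector bundle `E`: a smooth hermitian
metric, and a smooth trivialization of the top exterior power of `E`, given by the corresponding
nowhere vanishing alternating `n`-form on the fibers, which has modulus one on orthonormal
frames. The frames that are orthonormal and on which this form is `1` are the `SU(n)`-frames. -/
structure SUStructure (n : ℕ) where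
  inner : ∀ x, E x →ₗ⋆[ℂ] E x →ₗ[ℂ] ℂ
  inner_conj : ∀ x u v, starRingEnd ℂ (inner x u v) = inner x v u
  inner_pos : ∀ x u, u ≠ 0 → 0 < (inner x u u).re
  inner_smooth : ∀ e e' : Sec m F E, IsSmooth (m := m) (fun x => inner x (e x) (e' x))
  vol : ∀ x, E x [⋀^Fin n]→ₗ[ℂ] ℂ
  vol_smooth : ∀ e : Fin n → Sec m F E, IsSmooth (m := m) (fun x => vol x (fun i => e i x))
  vol_unit : ∀ x (u : Fin n → E x),
    (∀ i j, inner x (u i) (u j) = if i = j then 1 else 0) → ‖vol x u‖ = 1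

namespace SUStructure

variable {n : ℕ} (s : SUStructure m F E n)

/-- `T = S*` for the involution of `𝔄` defined by the hermitian metric. -/
def IsAdjoint (S T : EndAlg m F E) : Prop :=
  ∀ x u v, s.inner x (S.1 x u) v = s.inner x u (T.1 x v)

/-- `S* + S = 0`. -/
def Antihermitian (S : EndAlg m F E) : Prop := s.IsAdjoint S (-S)

/-- Real derivations: `(𝒳 S)* = 𝒳 (S*)` for all `S`. -/
def IsReal (D : Der (EndAlg m F E)) : Prop :=
  ∀ S T : EndAlg m F E, s.IsAdjoint S T → s.IsAdjoint (D S) (D T)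

/-- The conditions that characterize the noncommutative 1-forms of `SU(n)`-connections:
`α(ad_γ) = -γ` for traceless `γ`, `Tr α(𝒳) = 0` for all `𝒳`, and `α(𝒳)* + α(𝒳) = 0` for
all real `𝒳`. -/
structure IsSUForm (α : Form1 (EndAlg m F E)) : Prop where
  on_inner : ∀ γ : EndAlg m F E, γ.Traceless → α (ad γ) = -γ
  traceless : ∀ D : Der (EndAlg m F E), (α D).Traceless
  antihermitian : ∀ D : Der (EndAlg m F E), s.IsReal D → s.Antihermitian (α D)

/-- Elements of the gauge group: sections `U` of `End(E)` that are fiberwise unitary of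
determinant one. -/
def IsGauge (U : EndAlg m F E) : Prop :=
  ∀ x, (∀ u v, s.inner x (U.1 x u) (U.1 x v) = s.inner x u v) ∧ LinearMap.det (U.1 x) = 1

/-- `SU(n)`-connections on `E`: covariant derivatives `∇_X e` of smooth sections along smooth
vector fields that are compatible with the hermitian metric and for which the
trivialization of the top exterior power is parallel. -/
@[ext]
structure Connection [IsManifold (𝓡 m) ∞ M] where
  cov : VectorField m M → Sec m F E → Sec m F E
  add_field : ∀ X Y e, cov (X + Y) e = cov X e + cov Y e
  smul_field : ∀ (f : M → ℝ) (X Y : VectorField m M), ContMDiff (𝓡 m) 𝓘(ℝ, ℝ) ∞ f →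
    (∀ x, Y x = f x • X x) → ∀ e x, cov Y e x = f x • cov X e x
  add_section : ∀ X e e', cov X (e + e') = cov X e + cov X e'
  leibniz : ∀ X (f : M → ℂ) (hf : IsSmooth (m := m) f) e x,
    cov X (fsmul f hf e) x = dirDeriv X f x • e x + f x • cov X e x
  metric : ∀ X e e' x, dirDeriv X (fun y => s.inner y (e y) (e' y)) x =
    s.inner x (cov X e x) (e' x) + s.inner x (e x) (cov X e' x)
  volume : ∀ X (e : Fin n → Sec m F E) x, dirDeriv X (fun y => s.vol y (fun i => e i y)) x =
    ∑ i, s.vol x (Function.update (fun j => e j x) i (cov X (e i) x))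

end SUStructure

variable [IsManifold (𝓡 m) ∞ M]

/-- The restriction of the derivation `𝒳` of `𝔄` to the smooth complex valued functions is the
complex vector field `X + i Y`. -/
def RestrictsTo (D : Der (EndAlg m F E)) (X Y : VectorField m M) : Prop :=
  ∀ (f : M → ℂ) (hf : IsSmooth (m := m) f) (x : M),
    (D (EndAlg.scalar f hf)).1 x =
      (dirDeriv X f x + Complex.I * dirDeriv Y f x) • (1 : Module.End ℂ (E x))

namespace SUStructure.Connection

variable {n : ℕ} {s : SUStructure m F E n}

/-- The covariant derivative along the complex vector field `X + i Y`, by complex linearity. -/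
def covC (nab : s.Connection) (X Y : VectorField m M) (e : Sec m F E) (x : M) : E x :=
  nab.cov X e x + Complex.I • nab.cov Y e x

/-- `α` is the noncommutative 1-form of the connection: it has traceless values, and every
derivation `𝒳`, with `X + i Y` its associated complex vector field, decomposes as
`𝒳 S = ∇_{X + i Y} S - [α(𝒳), S]`. Here the connection on `End(E)` induced by the one on `E` is
given by `(∇ S) e = ∇ (S e) - S (∇ e)`. -/
def HasForm (nab : s.Connection) (α : Form1 (EndAlg m F E)) : Prop :=
  ∀ D : Der (EndAlg m F E), (α D).Traceless ∧
    ∃ X Y : VectorField m M, RestrictsTo D X Y ∧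
      ∀ (S : EndAlg m F E) (e : Sec m F E) (x : M),
        (D S).1 x (e x) =
          (nab.covC X Y (S.act e) x - S.1 x (nab.covC X Y e x)) -
            (α D * S - S * α D).1 x (e x)

/-- `nab'` is the transform of `nab` by the gauge group element `U`, that is
`∇'_X = U ∘ ∇_X ∘ U⁻¹`. -/
def IsGaugeTransform (U : EndAlg m F E) (nab nab' : s.Connection) : Prop :=
  ∀ X e, nab'.cov X (U.act e) = U.act (nab.cov X e)

end SUStructure.Connection

/-- `U = exp(t ξ)` fiberwise, for sections `U` and `ξ` of `End(E)`. -/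
def IsExp (t : ℝ) (ξ U : EndAlg m F E) : Prop :=
  ∀ x (v : E x),
    HasSum (fun k : ℕ => ((k.factorial : ℂ)⁻¹ * (t : ℂ) ^ k) • ((ξ.1 x) ^ k) v) (U.1 x v)

end Bundles

end NC

end

/-! The carrying identity is `HasForm.der_decomp`: if `α` is the form of `∇`, a derivation over the
complex vector field `X + iY` is `∇_X + i∇_Y - ad (α D)`, where `∇_X` is itself a derivation of the
endomorphism algebra (`exists_der`), real by metric compatibility (`der_isReal`). Two facts on
traceless sections make it effective: a central one vanishes (`eq_zero_of_commute`), and one whose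
inner derivation is real is antihermitian (`antihermitian_of_isReal_ad`). Both are tested on rank
one operators `e ↦ ⟨u, e⟩ v`, which leave a scalar multiple of the identity that the trace condition
kills.

It follows that `α (ad γ) = -γ` for traceless `γ`, because `ad γ` has zero vector field, and that `α
D` is antihermitian for real `D`, because then `Y = 0` and `ad (α D) = ∇_X - D` is real. Derivations
preserve tracelessness, since a parallel volume gives `Tr (∇γ) = 0` (`trace_covC_commutator`) and
commutators have trace zero. As `[D, ad γ] = ad (D γ)`, the Lie derivative of `α` kills `ad γ`, and
`α + L_D α` keeps the characteristic properties of a form.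

Conversely, let `α'` be any form with these properties. Then `α' - α` vanishes on the inner
derivations of traceless sections, so it depends only on the vector field; its values on the `∇_X`
are an endomorphism valued 1-form that can be added to `∇` (`HasForm.existsUnique`). For uniqueness,
two connections with one form differ by a scalar, which is zero because both preserve the volume.

For `D = ad ξ` the formula is a computation. To see it as an infinitesimal gauge transformation,
`exp (tξ)` is built fiberwise from matrix exponentials and is smooth because its coefficients in
local frames are. The transform `U ∇ U⁻¹` has form `U α U⁻¹ - (D U) U⁻¹`, which differs from `α` by
`U ∇ U⁻¹ - ∇` (`HasForm.gaugeForm_sub`). Its derivative at `t = 0` is `ξ ∇ - ∇ ξ`, once the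
derivatives in `t` and along `X` are interchanged (`tendsto_dirDeriv_slope`). -/

set_option linter.unusedSectionVars false
set_option linter.unusedVariables false

noncomputable section

namespace NC

/-! ### Cartan calculus for derivations of an abstract algebra -/

section Algebra

attribute [local instance 100] LieRing.ofAssociativeRing

variable {A : Type*} [Ring A] [Algebra ℂ A]

/-- The terms `D' (β D)` in the two halves of Cartan's formula cancel; every later computation uses
this shape. -/
theorem lieDeriv_apply (D : Der A) (β : Form1 A) (D' : Der A) :
    lieDeriv D β D' = D (β D') - β ⁅D, D'⁆ := by
  change D (β D') - D' (β D) - β ⁅D, D'⁆ + D' (β D) = _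
  abel

theorem Der.map_sub (D : Der A) (a b : A) : D (a - b) = D a - D b :=
  _root_.map_sub D.1 a b

theorem Der.map_smul (D : Der A) (c : ℂ) (a : A) : D (c • a) = c • D a :=
  _root_.map_smul D.1 c a

theorem Der.sub_apply (D D' : Der A) (a : A) : (D - D') a = D a - D' a := rfl

/-- The complex scalars in the center. -/
def centerScalar (c : ℂ) : Subalgebra.center ℂ A := algebraMap ℂ _ c

theorem Der.smul_eq_center_smul (c : ℂ) (D : Der A) :
    c • D = (centerScalar c : Subalgebra.center ℂ A) • D :=
  Der.ext fun a => by
    rw [Der.center_smul_apply, Der.smul_apply, Algebra.smul_def]; rfl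

/-- Forms are linear over the center, and complex constants are central. -/
theorem Form1.map_complex_smul (β : Form1 A) (c : ℂ) (D : Der A) : β (c • D) = c • β D := by
  rw [Der.smul_eq_center_smul, Form1.map_center_smul, Algebra.smul_def]; rfl

/-- The mixed terms of the two double Lie derivatives cancel in pairs; the rest is the Jacobi
identity in `Der A`. -/
theorem lieDeriv_lie (D D' : Der A) (β : Form1 A) :
    lieDeriv ⁅D, D'⁆ β = lieDeriv D (lieDeriv D' β) - lieDeriv D' (lieDeriv D β) := by
  ext D''
  simp only [lieDeriv_apply, LinearMap.sub_apply, Der.map_sub, Der.lie_apply]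
  rw [lie_lie, map_sub]
  abel

theorem lieDeriv_add_smul_left (a b : ℂ) (D D' : Der A) (β : Form1 A) :
    lieDeriv (a • D + b • D') β = a • lieDeriv D β + b • lieDeriv D' β := by
  ext D''
  simp only [lieDeriv_apply, LinearMap.add_apply, LinearMap.smul_apply, Der.add_apply,
    Der.smul_apply, add_lie, smul_lie, map_add, Form1.map_complex_smul, smul_sub]
  abel

theorem lieDeriv_add_smul_right (a b : ℂ) (D : Der A) (β β' : Form1 A) :
    lieDeriv D (a • β + b • β') = a • lieDeriv D β + b • lieDeriv D β' := by
  ext D''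
  simp only [lieDeriv_apply, LinearMap.add_apply, LinearMap.smul_apply, Der.map_add,
    Der.map_smul, smul_sub]
  abel

theorem ad_sub (a b : A) : ad (a - b) = ad a - ad b :=
  Der.ext fun c => by simp only [ad_apply, Der.sub_apply, sub_mul, mul_sub]; abel

theorem lie_ad (D : Der A) (a : A) : ⁅D, ad a⁆ = ad (D a) :=
  Der.ext fun b => by
    simp only [Der.lie_apply, ad_apply, Der.map_sub, Der.leibniz]
    abel

end Algebra

/-! ### Fiberwise operations, adjoints and real derivations -/

section Pointwise

variable {m : ℕ} {M : Type*} [TopologicalSpace M] [ChartedSpace (EuclideanSpace ℝ (Fin m)) M]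
  {F : Type*} [NormedAddCommGroup F] [NormedSpace ℂ F]
  {E : M → Type*} [∀ x, AddCommGroup (E x)] [∀ x, Module ℂ (E x)]
  [TopologicalSpace (TotalSpace F E)] [∀ x, TopologicalSpace (E x)] [FiberBundle F E]
  [VectorBundle ℂ F E] [VectorBundle ℝ F E]

namespace EndAlg

theorem ext_fiber {S T : EndAlg m F E} (h : ∀ x v, S.1 x v = T.1 x v) : S = T :=
  Subtype.ext (funext fun x => LinearMap.ext (h x))

theorem mul_apply (S T : EndAlg m F E) (x : M) (v : E x) : (S * T).1 x v = S.1 x (T.1 x v) := rfl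

theorem one_apply (x : M) (v : E x) : (1 : EndAlg m F E).1 x v = v := rfl

theorem add_apply (S T : EndAlg m F E) (x : M) (v : E x) : (S + T).1 x v = S.1 x v + T.1 x v := rfl

theorem sub_apply (S T : EndAlg m F E) (x : M) (v : E x) : (S - T).1 x v = S.1 x v - T.1 x v := rfl

theorem neg_apply (S : EndAlg m F E) (x : M) (v : E x) : (-S).1 x v = -S.1 x v := rfl

theorem smul_apply (c : ℂ) (S : EndAlg m F E) (x : M) (v : E x) : (c • S).1 x v = c • S.1 x v := rfl

theorem act_apply (S : EndAlg m F E) (e : Sec m F E) (x : M) : S.act e x = S.1 x (e x) := rfl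

theorem scalar_apply (f : M → ℂ) (hf : IsSmooth (m := m) f) (x : M) (v : E x) :
    (scalar (F := F) (E := E) f hf).1 x v = f x • v := rfl

theorem act_mul (S T : EndAlg m F E) (e : Sec m F E) : (S * T).act e = S.act (T.act e) := rfl

theorem act_one (e : Sec m F E) : (1 : EndAlg m F E).act e = e := rfl

theorem act_add_sec (S : EndAlg m F E) (e e' : Sec m F E) : S.act (e + e') = S.act e + S.act e' :=
  ContMDiffSection.ext fun x => _root_.map_add (S.1 x) _ _

theorem act_fsmul (S : EndAlg m F E) (f : M → ℂ) (hf : IsSmooth (m := m) f) (e : Sec m F E) :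
    S.act (fsmul f hf e) = fsmul f hf (S.act e) :=
  ContMDiffSection.ext fun x => _root_.map_smul (S.1 x) _ _

theorem Traceless.add {S T : EndAlg m F E} (hS : S.Traceless) (hT : T.Traceless) :
    (S + T).Traceless := fun x =>
  (_root_.map_add (LinearMap.trace ℂ (E x)) (S.1 x) (T.1 x)).trans (by rw [hS x, hT x, add_zero])

theorem Traceless.neg {S : EndAlg m F E} (hS : S.Traceless) : (-S).Traceless := fun x =>
  (_root_.map_neg (LinearMap.trace ℂ (E x)) (S.1 x)).trans (by rw [hS x, neg_zero])

theorem Traceless.sub {S T : EndAlg m F E} (hS : S.Traceless) (hT : T.Traceless) :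
    (S - T).Traceless := by
  rw [sub_eq_add_neg]; exact hS.add hT.neg

theorem Traceless.smul (c : ℂ) {S : EndAlg m F E} (hS : S.Traceless) :
    (c • S).Traceless := fun x =>
  (_root_.map_smul (LinearMap.trace ℂ (E x)) c (S.1 x)).trans (by rw [hS x, smul_zero])

/-- Multiplication by a smooth function, as an element of the center. -/
def scalarCenter (f : M → ℂ) (hf : IsSmooth (m := m) f) :
    Subalgebra.center ℂ (EndAlg m F E) :=
  ⟨scalar f hf, Subalgebra.mem_center_iff.2 fun S => ext_fiber fun x v =>
    _root_.map_smul (S.1 x) (f x) v⟩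

end EndAlg

theorem fsmul_apply (f : M → ℂ) (hf : IsSmooth (m := m) f) (e : Sec m F E) (x : M) :
    fsmul f hf e x = f x • e x := rfl

namespace SUStructure

variable {n : ℕ} (s : SUStructure m F E n)

/-- The operator `e ↦ ⟨u, e⟩ v` of rank one. -/
def rankOne (u v : Sec m F E) : EndAlg m F E :=
  ⟨fun x => (s.inner x (u x)).smulRight (v x), fun e =>
    (fsmul (fun x => s.inner x (u x) (e x)) (s.inner_smooth u e) v).contMDiff⟩

theorem rankOne_apply (u v : Sec m F E) (x : M) (y : E x) :
    (s.rankOne u v).1 x y = s.inner x (u x) y • v x := rfl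

theorem rankOne_act (u v e : Sec m F E) :
    (s.rankOne u v).act e =
      fsmul (fun x => s.inner x (u x) (e x)) (s.inner_smooth u e) v := rfl

/-- Rank one operators have explicit adjoints, so the reality of a derivation can be tested on them.
-/
theorem isAdjoint_rankOne (u v : Sec m F E) : s.IsAdjoint (s.rankOne u v) (s.rankOne v u) := by
  intro x a b
  simp only [rankOne_apply, map_smulₛₗ, LinearMap.smul_apply, s.inner_conj, smul_eq_mul, RingHom.id_apply]
  ring

variable {s}

theorem IsAdjoint.add {S S' T T' : EndAlg m F E} (h : s.IsAdjoint S T) (h' : s.IsAdjoint S' T') :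
    s.IsAdjoint (S + S') (T + T') := fun x u v => by
  simp only [EndAlg.add_apply, map_add, LinearMap.add_apply, h x u v, h' x u v]

theorem IsAdjoint.sub {S S' T T' : EndAlg m F E} (h : s.IsAdjoint S T) (h' : s.IsAdjoint S' T') :
    s.IsAdjoint (S - S') (T - T') := fun x u v => by
  simp only [EndAlg.sub_apply, map_sub, LinearMap.sub_apply, h x u v, h' x u v]

theorem IsAdjoint.smul (c : ℂ) {S T : EndAlg m F E} (h : s.IsAdjoint S T) :
    s.IsAdjoint (c • S) (starRingEnd ℂ c • T) := fun x u v => by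
  simp only [EndAlg.smul_apply, map_smulₛₗ, LinearMap.smul_apply, h x u v, RingHom.id_apply]

theorem IsAdjoint.mul {S S' T T' : EndAlg m F E} (h : s.IsAdjoint S T) (h' : s.IsAdjoint S' T') :
    s.IsAdjoint (S * S') (T' * T) := fun x u v => by
  simp only [EndAlg.mul_apply, h x _ v, h' x u _]

theorem IsReal.lie {D D' : Der (EndAlg m F E)} (h : s.IsReal D) (h' : s.IsReal D') :
    s.IsReal ⁅D, D'⁆ := fun S T hST => by
  rw [Der.lie_apply, Der.lie_apply]
  exact (h _ _ (h' _ _ hST)).sub (h' _ _ (h _ _ hST))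

theorem IsReal.add {D D' : Der (EndAlg m F E)} (h : s.IsReal D) (h' : s.IsReal D') :
    s.IsReal (D + D') := fun S T hST => (h _ _ hST).add (h' _ _ hST)

theorem IsReal.sub {D D' : Der (EndAlg m F E)} (h : s.IsReal D) (h' : s.IsReal D') :
    s.IsReal (D - D') := fun S T hST => by
  rw [Der.sub_apply, Der.sub_apply]
  exact (h _ _ hST).sub (h' _ _ hST)

theorem IsReal.smul (a : ℝ) {D : Der (EndAlg m F E)} (h : s.IsReal D) :
    s.IsReal ((a : ℂ) • D) := fun S T hST => by
  rw [Der.smul_apply, Der.smul_apply]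
  simpa using (h _ _ hST).smul (a : ℂ)

theorem isReal_ad {a : EndAlg m F E} (h : s.Antihermitian a) : s.IsReal (ad a) :=
  fun S T hST => by
    have := (h.mul hST).sub (hST.mul h)
    rw [ad_apply, ad_apply]
    convert this using 1
    noncomm_ring

end SUStructure

end Pointwise

/-! ### Linear algebra of top degree alternating forms -/

section TopForms

variable {V : Type*} [AddCommGroup V] [Module ℂ V] {n : ℕ}

/-- In a basis the form is a multiple of the determinant, and changing one vector changes one
column, as in Cramer's rule. -/
theorem topForm_update (b : Module.Basis (Fin n) ℂ V) (τ : V [⋀^Fin n]→ₗ[ℂ] ℂ) (v : Fin n → V)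
    (i : Fin n) (y : V) :
    τ (Function.update v i y) = τ b * (b.toMatrix v).cramer (b.repr y) i := by
  conv_lhs => rw [τ.eq_smul_basis_det b]
  rw [AlternatingMap.smul_apply, Module.Basis.det_apply, Module.Basis.toMatrix_update,
    Matrix.cramer_apply, smul_eq_mul]

theorem topForm_apply (b : Module.Basis (Fin n) ℂ V) (τ : V [⋀^Fin n]→ₗ[ℂ] ℂ) (v : Fin n → V) :
    τ v = τ b * (b.toMatrix v).det := by
  conv_lhs => rw [τ.eq_smul_basis_det b]
  rw [AlternatingMap.smul_apply, Module.Basis.det_apply, smul_eq_mul]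

/-- Cramer's rule for a top degree form. -/
theorem topForm_smul (b : Module.Basis (Fin n) ℂ V) (τ : V [⋀^Fin n]→ₗ[ℂ] ℂ) (v : Fin n → V)
    (y : V) : τ v • y = ∑ i, τ (Function.update v i y) • v i := by
  apply b.repr.injective
  ext k
  have h := congrFun (Matrix.mulVec_cramer (b.toMatrix v) (b.repr y)) k
  simp only [Matrix.mulVec, dotProduct, Module.Basis.toMatrix_apply, Pi.smul_apply,
    smul_eq_mul] at h
  simp only [map_smul, map_sum, Finsupp.smul_apply, Finsupp.finsetSum_apply, smul_eq_mul,
    topForm_update b, topForm_apply b τ v]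
  rw [mul_assoc, ← h, Finset.mul_sum]
  exact Finset.sum_congr rfl fun i _ => by ring

/-- With `P` the matrix of `v`, the sum is a multiple of `tr (adj P · A · P) = tr (A · P · adj P) =
det P · tr A`. The adjugate allows `v` to be linearly dependent, which is needed when vectors of a
frame are replaced. -/
theorem sum_topForm_update (b : Module.Basis (Fin n) ℂ V) (τ : V [⋀^Fin n]→ₗ[ℂ] ℂ)
    (A : Module.End ℂ V) (v : Fin n → V) :
    ∑ i, τ (Function.update v i (A (v i))) = LinearMap.trace ℂ V A * τ v := by
  have h1 : ∀ i, τ (Function.update v i (A (v i))) =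
      τ b * ((b.toMatrix v).adjugate * (LinearMap.toMatrix b b A * b.toMatrix v)) i i := by
    intro i
    rw [topForm_update b, Matrix.cramer_eq_adjugate_mulVec]
    congr 1
    simp only [Matrix.mulVec, dotProduct, Matrix.mul_apply (M := (b.toMatrix v).adjugate)]
    refine Finset.sum_congr rfl fun j _ => ?_
    congr 1
    have := congrFun (LinearMap.toMatrix_mulVec_repr b b A (v i)) j
    rw [← this]
    rfl
  rw [Finset.sum_congr rfl fun i _ => h1 i, ← Finset.mul_sum, topForm_apply b τ v,
    LinearMap.trace_eq_matrix_trace ℂ b]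
  change τ b * Matrix.trace _ = _
  rw [Matrix.trace_mul_comm, Matrix.mul_assoc, Matrix.mul_adjugate, mul_smul_comm, mul_one,
    Matrix.trace_smul, smul_eq_mul]
  ring

theorem topForm_comp (b : Module.Basis (Fin n) ℂ V) (τ : V [⋀^Fin n]→ₗ[ℂ] ℂ)
    (A : Module.End ℂ V) (v : Fin n → V) :
    τ (fun i => A (v i)) = LinearMap.det A * τ v := by
  rw [τ.eq_smul_basis_det b, AlternatingMap.smul_apply, AlternatingMap.smul_apply]
  have := b.det_comp A v
  change b.det (fun i => A (v i)) = _ at this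
  rw [this, smul_eq_mul, smul_eq_mul]
  ring

end TopForms

/-! ### Orthonormal bases for a hermitian form -/

section Orthonormal

variable {V : Type*} [AddCommGroup V] [Module ℂ V] [FiniteDimensional ℂ V]

theorem exists_orthonormal_basis {n : ℕ} (hn : Module.finrank ℂ V = n)
    (B : V →ₗ⋆[ℂ] V →ₗ[ℂ] ℂ) (hconj : ∀ u v, starRingEnd ℂ (B u v) = B v u)
    (hpos : ∀ u, u ≠ 0 → 0 < (B u u).re) :
    ∃ b : Module.Basis (Fin n) ℂ V, ∀ i j, B (b i) (b j) = if i = j then 1 else 0 := by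
  let c : InnerProductSpace.Core ℂ V :=
    { inner := fun u v => B u v
      conj_inner_symm := fun u v => hconj v u
      re_inner_nonneg := fun u => by
        by_cases h : u = 0
        · simp [h]
        · exact (hpos u h).le
      add_left := fun u v w => by simp
      smul_left := fun u v r => by simp
      definite := fun u h => by
        by_contra hu
        have := hpos u hu
        change B u u = 0 at h
        simp [h] at this }
  let := c.toNormedAddCommGroup
  let : InnerProductSpace ℂ V := InnerProductSpace.ofCore c.toCore
  let e := (stdOrthonormalBasis ℂ V).reindex (finCongr hn)
  refine ⟨e.toBasis, fun i j => ?_⟩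
  rw [OrthonormalBasis.coe_toBasis]
  exact orthonormal_iff_ite.1 e.orthonormal i j

end Orthonormal

/-! ### Sections through given vectors -/

section Sections

variable {m : ℕ} {M : Type*} [TopologicalSpace M] [ChartedSpace (EuclideanSpace ℝ (Fin m)) M]
  {F : Type*} [NormedAddCommGroup F] [NormedSpace ℂ F]
  {E : M → Type*} [∀ x, AddCommGroup (E x)] [∀ x, Module ℂ (E x)]
  [TopologicalSpace (TotalSpace F E)] [∀ x, TopologicalSpace (E x)] [FiberBundle F E]
  [VectorBundle ℂ F E] [VectorBundle ℝ F E]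

variable (F E) in
/-- The fiber of `E` at `x` is isomorphic to the model fiber. -/
def fiberEquiv (x : M) : E x ≃L[ℂ] F :=
  (trivializationAt F E x).continuousLinearEquivAt ℂ x
    (FiberBundle.mem_baseSet_trivializationAt' x)

include F in
theorem finrank_fiber (x : M) : Module.finrank ℂ (E x) = Module.finrank ℂ F :=
  (fiberEquiv F E x).toLinearEquiv.finrank_eq

include F in
theorem finiteDimensional_fiber [FiniteDimensional ℂ F] (x : M) : FiniteDimensional ℂ (E x) :=
  (fiberEquiv F E x).toLinearEquiv.symm.finiteDimensional

variable [IsManifold (𝓡 m) ∞ M]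

theorem exists_bump [T2Space M] {x : M} {u : Set M} (hu : u ∈ 𝓝 x) :
    ∃ f : SmoothBumpFunction (𝓡 m) x, tsupport f ⊆ u := by
  obtain ⟨f, -, hf⟩ := (SmoothBumpFunction.nhds_basis_tsupport (I := 𝓡 m) x).mem_iff.1 hu
  exact ⟨f, hf⟩

/-- Every vector in a fiber is the value of a smooth section. -/
theorem exists_section [T2Space M] [ContMDiffVectorBundle ∞ F E (𝓡 m)] {x : M} (v : E x) :
    ∃ e : Sec m F E, e x = v := by
  obtain ⟨u, hu, hs⟩ := FiberBundle.exists_contMDiffOn_extend (k := ∞) (𝓡 m) F v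
  obtain ⟨o, hou, ho, hxo⟩ := mem_nhds_iff.1 hu
  obtain ⟨f, hf⟩ := exists_bump (m := m) (ho.mem_nhds hxo)
  -- The local extension is cut off by a bump function supported where it is smooth; off the support
  -- the product is locally the zero section.
  refine ⟨⟨fun y => f y • FiberBundle.extend F v y, fun y => ?_⟩, ?_⟩
  · by_cases hy : y ∈ tsupport f
    · exact (f.contMDiff y).smul_section
        ((hs.mono hou).contMDiffAt (ho.mem_nhds (hf hy)))
    · have h0 : ContMDiffAt (𝓡 m) ((𝓡 m).prod 𝓘(ℝ, F)) ∞
          (fun y => TotalSpace.mk' F y ((0 : Sec m F E) y)) y :=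
        (0 : Sec m F E).contMDiff y
      refine h0.congr_of_eventuallyEq ?_
      filter_upwards [(isClosed_tsupport f).isOpen_compl.mem_nhds hy] with z hz
      rw [image_eq_zero_of_notMem_tsupport hz, zero_smul]
      rfl
  · change f x • FiberBundle.extend F v x = v
    rw [f.eq_one, one_smul, FiberBundle.extend_apply_self]

theorem EndAlg.ext_act [T2Space M] [ContMDiffVectorBundle ∞ F E (𝓡 m)] {S T : EndAlg m F E}
    (h : ∀ e, S.act e = T.act e) : S = T :=
  EndAlg.ext_fiber fun x v => by
    obtain ⟨e, rfl⟩ := exists_section (m := m) (F := F) v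
    exact congrArg (fun e : Sec m F E => e x) (h e)

end Sections

/-! ### Directional derivatives of complex valued functions -/

section DirDeriv

variable {m : ℕ} {M : Type*} [TopologicalSpace M] [ChartedSpace (EuclideanSpace ℝ (Fin m)) M]
  [IsManifold (𝓡 m) ∞ M]

/-- Differentiability of a complex valued function at a point. -/
abbrev IsDiffAt (f : M → ℂ) (x : M) : Prop := MDifferentiableAt (𝓡 m) 𝓘(ℝ, ℂ) f x

theorem IsSmooth.isDiffAt {f : M → ℂ} (hf : IsSmooth (m := m) f) (x : M) :
    IsDiffAt (m := m) f x :=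
  (hf x).mdifferentiableAt (by simp)

theorem dirDeriv_congr (X : VectorField m M) {f g : M → ℂ} {x : M} (h : f =ᶠ[𝓝 x] g) :
    dirDeriv X f x = dirDeriv X g x := by
  unfold dirDeriv
  rw [h.mfderiv_eq]
  rfl

theorem dirDeriv_zero_field (f : M → ℂ) (x : M) : dirDeriv (0 : VectorField m M) f x = 0 :=
  map_zero (mfderiv (𝓡 m) 𝓘(ℝ, ℂ) f x)

theorem dirDeriv_const (X : VectorField m M) (c : ℂ) (x : M) :
    dirDeriv X (fun _ => c) x = 0 := by
  unfold dirDeriv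
  rw [mfderiv_const]
  rfl

theorem dirDeriv_comp {V : Type*} [NormedAddCommGroup V] [NormedSpace ℝ V] (X : VectorField m M)
    {f : V → ℂ} {g : M → V} {x : M} (hf : DifferentiableAt ℝ f (g x))
    (hg : MDifferentiableAt (𝓡 m) 𝓘(ℝ, V) g x) :
    dirDeriv X (fun y => f (g y)) x = fderiv ℝ f (g x) (mfderiv (𝓡 m) 𝓘(ℝ, V) g x (X x)) := by
  have h := mfderiv_comp x hf.mdifferentiableAt hg
  rw [mfderiv_eq_fderiv] at h
  unfold dirDeriv
  exact congrArg (fun L => L (X x)) h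

theorem dirDeriv_clm_comp {V : Type*} [NormedAddCommGroup V] [NormedSpace ℝ V]
    (X : VectorField m M) (L : V →L[ℝ] ℂ) {g : M → V} {x : M}
    (hg : MDifferentiableAt (𝓡 m) 𝓘(ℝ, V) g x) :
    dirDeriv X (fun y => L (g y)) x = L (mfderiv (𝓡 m) 𝓘(ℝ, V) g x (X x)) := by
  rw [dirDeriv_comp X L.differentiableAt hg, L.fderiv]

theorem dirDeriv_add (X : VectorField m M) {f g : M → ℂ} {x : M}
    (hf : IsDiffAt (m := m) f x) (hg : IsDiffAt (m := m) g x) :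
    dirDeriv X (fun y => f y + g y) x = dirDeriv X f x + dirDeriv X g x := by
  unfold dirDeriv
  exact congrArg (fun L => L (X x)) (mfderiv_add hf hg)

theorem dirDeriv_mul (X : VectorField m M) {f g : M → ℂ} {x : M}
    (hf : IsDiffAt (m := m) f x) (hg : IsDiffAt (m := m) g x) :
    dirDeriv X (fun y => f y * g y) x = f x * dirDeriv X g x + dirDeriv X f x * g x := by
  have h := congrArg (fun L => L (X x)) (hf.hasMFDerivAt.mul hg.hasMFDerivAt).mfderiv
  have h' : dirDeriv X (fun y => f y * g y) x = f x * dirDeriv X g x + g x * dirDeriv X f x := h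
  rw [h', mul_comm (g x)]

theorem dirDeriv_const_mul (X : VectorField m M) (c : ℂ) {f : M → ℂ} {x : M}
    (hf : IsDiffAt (m := m) f x) :
    dirDeriv X (fun y => c * f y) x = c * dirDeriv X f x := by
  rw [dirDeriv_mul X mdifferentiableAt_const hf, dirDeriv_const]
  ring

theorem dirDeriv_sum {ι : Type*} (t : Finset ι) (X : VectorField m M) {f : ι → M → ℂ} {x : M}
    (hf : ∀ i, IsDiffAt (m := m) (f i) x) :
    IsDiffAt (m := m) (fun y => ∑ i ∈ t, f i y) x ∧
      dirDeriv X (fun y => ∑ i ∈ t, f i y) x = ∑ i ∈ t, dirDeriv X (f i) x := by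
  classical
  induction t using Finset.induction_on with
  | empty => simpa using ⟨mdifferentiableAt_const, dirDeriv_const X 0 x⟩
  | insert a t ha ih =>
    simp only [Finset.sum_insert ha]
    exact ⟨(hf a).add ih.1, by rw [dirDeriv_add X (hf a) ih.1, ih.2]⟩

theorem dirDeriv_im_eq_zero (X : VectorField m M) {f : M → ℂ} (hf : IsSmooth (m := m) f)
    (hreal : ∀ y, (f y).im = 0) (x : M) : (dirDeriv X f x).im = 0 := by
  have h := dirDeriv_clm_comp X (Complex.ofRealCLM.comp Complex.imCLM) (hf.isDiffAt x)
  have h0 : (fun y => (Complex.ofRealCLM.comp Complex.imCLM) (f y)) = fun _ => (0 : ℂ) := by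
    funext y; simp [hreal y]
  rw [h0, dirDeriv_const] at h
  exact (Complex.ofReal_eq_zero.1 h.symm)

/-- The coordinates of a chart, cut off away from its center. -/
theorem exists_coordinate [T2Space M] (x : M) (i : Fin m) :
    ∃ f : M → ℂ, IsSmooth (m := m) f ∧ (∀ y, (f y).im = 0) ∧
      ∀ X : VectorField m M,
        dirDeriv X f x = ((EuclideanSpace.proj i : EuclideanSpace ℝ (Fin m) →L[ℝ] ℝ) (X x) : ℝ) := by
  obtain ⟨χ, hχ⟩ := exists_bump (m := m) (x := x) Filter.univ_mem
  let g : M → EuclideanSpace ℝ (Fin m) := fun y => χ y • extChartAt (𝓡 m) x y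
  have hg : ContMDiff (𝓡 m) 𝓘(ℝ, EuclideanSpace ℝ (Fin m)) ∞ g :=
    χ.contMDiff_smul (by
      exact contMDiffOn_extChartAt (I := 𝓡 m) (n := ∞) (x := x))
  let L : EuclideanSpace ℝ (Fin m) →L[ℝ] ℂ := Complex.ofRealCLM.comp (EuclideanSpace.proj i)
  refine ⟨fun y => L (g y), L.contMDiff.comp hg, fun y => Complex.ofReal_im _, fun X => ?_⟩
  have hd : MDifferentiableAt (𝓡 m) 𝓘(ℝ, EuclideanSpace ℝ (Fin m)) g x :=
    (hg x).mdifferentiableAt (by simp)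
  rw [dirDeriv_clm_comp X L hd]
  have he : g =ᶠ[𝓝 x] extChartAt (𝓡 m) x := by
    filter_upwards [χ.eventuallyEq_one] with y hy
    simp [g, hy]
  have : IsManifold (𝓡 m) 1 M := inferInstance
  have h := congrArg (fun L => L (X x)) (he.mfderiv_eq (I := 𝓡 m)
    (I' := 𝓘(ℝ, EuclideanSpace ℝ (Fin m))))
  have h2 : mfderiv (𝓡 m) 𝓘(ℝ, EuclideanSpace ℝ (Fin m)) g x (X x) = X x := by
    refine h.trans ?_
    -- The tangent space at `x` is identified with the model by the preferred chart at `x`, so the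
    -- derivative of that chart there is the identity.
    have := congrArg (fun L => L (X x)) (mfderiv_extChartAt_self (I := 𝓡 m) (x := x))
    exact this
  rw [h2]
  rfl

/-- A complex vector field is determined by its action on smooth functions. -/
theorem vectorField_ext [T2Space M] {X Y X' Y' : VectorField m M}
    (h : ∀ f : M → ℂ, IsSmooth (m := m) f → ∀ x, dirDeriv X f x + Complex.I * dirDeriv Y f x =
      dirDeriv X' f x + Complex.I * dirDeriv Y' f x) : X = X' ∧ Y = Y' := by
  let p (i : Fin m) : EuclideanSpace ℝ (Fin m) →L[ℝ] ℝ := EuclideanSpace.proj i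
  have key : ∀ (x : M) (i : Fin m), p i (X x) = p i (X' x) ∧ p i (Y x) = p i (Y' x) := by
    intro x i
    -- Coordinate functions are real, so the real and imaginary parts of the equation separate the
    -- two vector fields.
    obtain ⟨f, hf, -, hX⟩ := exists_coordinate x i
    have := h f hf x
    rw [hX, hX, hX, hX] at this
    have h1 := congrArg Complex.re this
    have h2 := congrArg Complex.im this
    simp only [Complex.add_re, Complex.add_im, Complex.ofReal_re, Complex.ofReal_im,
      Complex.I_mul_re, Complex.I_mul_im, neg_zero, add_zero, zero_add] at h1 h2
    exact ⟨h1, h2⟩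
  exact ⟨ContMDiffSection.ext fun x => PiLp.ext fun i => (key x i).1,
    ContMDiffSection.ext fun x => PiLp.ext fun i => (key x i).2⟩

end DirDeriv

/-! ### Pointwise frames, central and antihermitian sections, tensoriality -/

section Fibers

variable {m : ℕ} {M : Type*} [TopologicalSpace M] [ChartedSpace (EuclideanSpace ℝ (Fin m)) M]
  {F : Type*} [NormedAddCommGroup F] [NormedSpace ℂ F]
  {E : M → Type*} [∀ x, AddCommGroup (E x)] [∀ x, Module ℂ (E x)]
  [TopologicalSpace (TotalSpace F E)] [∀ x, TopologicalSpace (E x)] [FiberBundle F E]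
  [VectorBundle ℂ F E] [VectorBundle ℝ F E]
  {n : ℕ} {s : SUStructure m F E n}

theorem isSmooth_const (c : ℂ) : IsSmooth (m := m) (fun _ : M => c) := contMDiff_const

namespace SUStructure

variable (s) in
theorem exists_orthonormal (hn : 0 < n) (hF : Module.finrank ℂ F = n) (x : M) :
    ∃ b : Module.Basis (Fin n) ℂ (E x), ∀ i j, s.inner x (b i) (b j) = if i = j then 1 else 0 := by
  have : FiniteDimensional ℂ F := Module.finite_of_finrank_pos (by omega)
  have := finiteDimensional_fiber (F := F) (E := E) x
  exact exists_orthonormal_basis ((finrank_fiber (F := F) x).trans hF) (s.inner x)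
    (s.inner_conj x) (s.inner_pos x)

theorem repr_eq_inner {x : M} {b : Module.Basis (Fin n) ℂ (E x)}
    (hb : ∀ i j, s.inner x (b i) (b j) = if i = j then 1 else 0) (v : E x) (i : Fin n) :
    b.repr v i = s.inner x (b i) v := by
  have h := congrArg (s.inner x (b i)) (b.sum_repr v)
  rw [map_sum] at h
  rw [← h]
  simp only [map_smul, hb, smul_eq_mul, mul_ite, mul_one, mul_zero, Finset.sum_ite_eq,
    Finset.mem_univ, if_true]

theorem trace_eq_sum_inner {x : M} {b : Module.Basis (Fin n) ℂ (E x)}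
    (hb : ∀ i j, s.inner x (b i) (b j) = if i = j then 1 else 0) (A : Module.End ℂ (E x)) :
    LinearMap.trace ℂ (E x) A = ∑ i, s.inner x (b i) (A (b i)) := by
  rw [LinearMap.trace_eq_matrix_trace ℂ b]
  exact Finset.sum_congr rfl fun i _ => by
    rw [Matrix.diag_apply, LinearMap.toMatrix_apply, repr_eq_inner hb]

theorem vol_orthonormal_ne_zero {x : M} {b : Module.Basis (Fin n) ℂ (E x)}
    (hb : ∀ i j, s.inner x (b i) (b j) = if i = j then 1 else 0) : s.vol x b ≠ 0 := fun h => by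
  have := s.vol_unit x b hb
  rw [h] at this
  simp at this

variable [IsManifold (𝓡 m) ∞ M] [T2Space M] [ContMDiffVectorBundle ∞ F E (𝓡 m)]

variable (s) in
/-- Smooth sections that are orthonormal at a given point. -/
theorem exists_frame (hn : 0 < n) (hF : Module.finrank ℂ F = n) (x : M) :
    ∃ (b : Module.Basis (Fin n) ℂ (E x)) (e : Fin n → Sec m F E), (∀ i, e i x = b i) ∧
      (∀ i j, s.inner x (b i) (b j) = if i = j then 1 else 0) ∧ s.vol x (fun i => e i x) ≠ 0 := by
  obtain ⟨b, hb⟩ := s.exists_orthonormal hn hF x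
  choose e he using fun i => exists_section (m := m) (F := F) (b i)
  refine ⟨b, e, he, hb, ?_⟩
  rw [funext he]
  exact vol_orthonormal_ne_zero hb

/-- The sum is the trace times the volume of the frame, and some frame has nonzero volume at `x`. In
this form the parallel volume of a connection yields vanishing traces. -/
theorem trace_eq_zero_of_vol (s : SUStructure m F E n) (hn : 0 < n) (hF : Module.finrank ℂ F = n)
    {x : M} (A : Module.End ℂ (E x))
    (h : ∀ e : Fin n → Sec m F E,
      ∑ i, s.vol x (Function.update (fun j => e j x) i (A (e i x))) = 0) :
    LinearMap.trace ℂ (E x) A = 0 := by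
  obtain ⟨b, e, -, -, hv⟩ := s.exists_frame hn hF x
  have := h e
  rw [sum_topForm_update b] at this
  exact (mul_eq_zero.1 this).resolve_right hv

/-- A traceless section of `End(E)` in the center vanishes. -/
theorem eq_zero_of_commute (s : SUStructure m F E n) (hn : 0 < n) (hF : Module.finrank ℂ F = n)
    {a : EndAlg m F E} (ha : a.Traceless) (h : ∀ S, a * S = S * a) : a = 0 := by
  refine EndAlg.ext_fiber fun x => ?_
  obtain ⟨b, e, he, hb, -⟩ := s.exists_frame hn hF x
  let o : Fin n := ⟨0, hn⟩
  -- Commuting with the operator that sends `b o` to `v` and kills its complement makes `a` a scalar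
  -- at `x`; the trace is then `n` times that scalar.
  have key : ∀ v, a.1 x v = s.inner x (b o) (a.1 x (b o)) • v := by
    intro v
    obtain ⟨w, rfl⟩ := exists_section (m := m) (F := F) v
    have h1 : (a * s.rankOne (e o) w).1 x (b o) = (s.rankOne (e o) w * a).1 x (b o) := by rw [h]
    simpa only [EndAlg.mul_apply, rankOne_apply, he, hb, map_smul, one_smul, if_true] using h1
  have h2 := ha x
  rw [trace_eq_sum_inner hb] at h2
  have h3 : ∀ i, s.inner x (b i) (a.1 x (b i)) = s.inner x (b o) (a.1 x (b o)) := by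
    intro i
    rw [key (b i), map_smul, hb, if_pos rfl, smul_eq_mul, mul_one]
  rw [Finset.sum_congr rfl fun i _ => h3 i, Finset.sum_const, Finset.card_univ,
    Fintype.card_fin, nsmul_eq_mul] at h2
  have h4 := (mul_eq_zero.1 h2).resolve_left (by exact_mod_cast hn.ne')
  intro v
  rw [key, h4, zero_smul]
  rfl

/-- Reality of `ad a`, tested on rank one operators, makes `a + a*` a scalar `c` at each point.
Taking traces, `n c` is the trace of `a` plus its conjugate, hence zero. -/
theorem antihermitian_of_isReal_ad (hn : 0 < n) (hF : Module.finrank ℂ F = n)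
    {a : EndAlg m F E} (ha : a.Traceless) (h : s.IsReal (ad a)) : s.Antihermitian a := by
  intro x
  obtain ⟨b, e, he, hb, -⟩ := s.exists_frame hn hF x
  let o : Fin n := ⟨0, hn⟩
  obtain ⟨c, hc⟩ : ∃ c, ∀ v q, s.inner x (a.1 x v) q + s.inner x v (a.1 x q) =
      c * s.inner x v q := by
    refine ⟨s.inner x (b o) (a.1 x (b o)) + s.inner x (a.1 x (b o)) (b o), fun v q => ?_⟩
    obtain ⟨w, rfl⟩ := exists_section (m := m) (F := F) v
    have h1 := h _ _ (s.isAdjoint_rankOne (e o) w) x (b o) q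
    simp only [ad_apply, EndAlg.sub_apply, EndAlg.mul_apply, rankOne_apply, he, hb, map_smul,
      one_smul, if_true, map_sub, LinearMap.sub_apply, map_smulₛₗ, LinearMap.smul_apply,
      s.inner_conj, smul_eq_mul, mul_one] at h1
    linear_combination h1
  have h2 : (n : ℂ) * c = 0 := by
    have h3 : ∑ i, (s.inner x (a.1 x (b i)) (b i) + s.inner x (b i) (a.1 x (b i))) = n * c := by
      simp [hc, hb]
    rw [← h3, Finset.sum_add_distrib, ← trace_eq_sum_inner hb, ha x, add_zero]
    have h4 := congrArg (starRingEnd ℂ) ((trace_eq_sum_inner hb (a.1 x)).symm.trans (ha x))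
    rw [map_sum, map_zero] at h4
    simpa only [s.inner_conj] using h4
  have h5 := (mul_eq_zero.1 h2).resolve_left (by exact_mod_cast hn.ne')
  intro u v
  have := hc u v
  rw [h5, zero_mul] at this
  rw [EndAlg.neg_apply, map_neg]
  linear_combination this

section Tensorial

/-- Evaluation of a section at a point. -/
def evalHom (x : M) : Sec m F E →+ E x where
  toFun e := e x
  map_zero' := rfl
  map_add' _ _ := rfl

theorem sum_sec_apply {ι : Type*} (t : Finset ι) (e : ι → Sec m F E) (x : M) :
    (∑ i ∈ t, e i) x = ∑ i ∈ t, e i x :=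
  map_sum (evalHom (m := m) (F := F) (E := E) x) e t

variable (s) in
/-- The `i`-th coordinate of a section in a frame, multiplied by the volume of the frame. -/
theorem isSmooth_vol_update (e : Fin n → Sec m F E) (i : Fin n) (y : Sec m F E) :
    IsSmooth (m := m) (fun x => s.vol x (Function.update (fun j => e j x) i (y x))) := by
  have := s.vol_smooth (Function.update e i y)
  convert this using 3 with x
  ext j
  by_cases h : j = i
  · subst h; simp
  · simp [h]

-- Cramer's rule without division holds globally, even where the family `e` degenerates. Function
-- linear maps can thus be applied to it with no localization.
variable (s) in
theorem fsmul_vol (hn : 0 < n) (hF : Module.finrank ℂ F = n) (e : Fin n → Sec m F E)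
    (y : Sec m F E) :
    fsmul (fun x => s.vol x (fun i => e i x)) (s.vol_smooth e) y =
      ∑ i, fsmul (fun x => s.vol x (Function.update (fun j => e j x) i (y x)))
        (s.isSmooth_vol_update e i y) (e i) := by
  refine ContMDiffSection.ext fun x => ?_
  obtain ⟨b, -⟩ := s.exists_orthonormal hn hF x
  rw [sum_sec_apply]
  exact topForm_smul b (s.vol x) (fun i => e i x) (y x)

/-- Function linear operations on sections are given by sections of the endomorphism bundle. -/
theorem exists_endAlg_of_tensorial (s : SUStructure m F E n) (hn : 0 < n)
    (hF : Module.finrank ℂ F = n)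
    (Φ : Sec m F E → Sec m F E) (hadd : ∀ e e', Φ (e + e') = Φ e + Φ e')
    (hsmul : ∀ f (hf : IsSmooth (m := m) f) e x, Φ (fsmul f hf e) x = f x • Φ e x) :
    ∃ S : EndAlg m F E, ∀ e, S.act e = Φ e := by
  let Ψ : Sec m F E →+ Sec m F E := AddMonoidHom.mk' Φ hadd
  -- In Cramer's expansion of `vol(e) y`, all coefficients vanish at `x` with `y`, while `vol(e)`
  -- does not; applying `Φ` gives the claim.
  have h0 : ∀ e x, e x = 0 → Φ e x = 0 := by
    intro y x hy
    obtain ⟨b, e, he, hb, hv⟩ := s.exists_frame hn hF x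
    have h1 := congrArg (fun z => Ψ z x) (s.fsmul_vol hn hF e y)
    simp only [map_sum, sum_sec_apply] at h1
    have h2 : ∀ i, Ψ (fsmul (fun x => s.vol x (Function.update (fun j => e j x) i (y x)))
        (s.isSmooth_vol_update e i y) (e i)) x = 0 := fun i => by
      refine (hsmul _ _ _ _).trans ?_
      rw [hy, AlternatingMap.map_update_zero, zero_smul]
    rw [Finset.sum_congr rfl fun i _ => h2 i, Finset.sum_const_zero] at h1
    exact (smul_eq_zero.1 ((hsmul _ _ _ _).symm.trans h1)).resolve_left hv
  have hw : ∀ e e' x, e x = e' x → Φ e x = Φ e' x := by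
    intro e e' x h
    have h1 := h0 (e - e') x (by
      change e x - e' x = 0
      rw [h, sub_self])
    have h2 : Φ (e - e') = Φ e - Φ e' := map_sub Ψ e e'
    rw [h2] at h1
    exact sub_eq_zero.1 h1
  -- The chosen sections need not depend linearly or smoothly on the vector: by `hw` only their
  -- values at `x` matter.
  choose σ hσ using fun (x : M) (v : E x) => exists_section (m := m) (F := F) v
  refine ⟨⟨fun x =>
    { toFun := fun v => Φ (σ x v) x
      map_add' := fun v w => ?_
      map_smul' := fun c v => ?_ }, fun e => ?_⟩, fun e => ContMDiffSection.ext fun x => ?_⟩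
  · rw [hw _ (σ x v + σ x w) x (by
      change _ = σ x v x + σ x w x
      rw [hσ, hσ, hσ]), hadd]
    rfl
  · rw [hw _ (fsmul (fun _ => c) (isSmooth_const c) (σ x v)) x (by
      change _ = c • σ x v x
      rw [hσ, hσ]), hsmul]
    rfl
  · convert (Φ e).contMDiff using 3 with x
    exact hw _ _ _ (hσ _ _)
  · exact hw _ _ _ (hσ _ _)

end Tensorial

end SUStructure

end Fibers

/-! ### Covariant derivatives as derivations, and the decomposition of derivations -/

section Connections

variable {m : ℕ} {M : Type*} [TopologicalSpace M] [ChartedSpace (EuclideanSpace ℝ (Fin m)) M]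
  {F : Type*} [NormedAddCommGroup F] [NormedSpace ℂ F]
  {E : M → Type*} [∀ x, AddCommGroup (E x)] [∀ x, Module ℂ (E x)]
  [TopologicalSpace (TotalSpace F E)] [∀ x, TopologicalSpace (E x)] [FiberBundle F E]
  [VectorBundle ℂ F E] [VectorBundle ℝ F E]
  {n : ℕ} {s : SUStructure m F E n}
  [IsManifold (𝓡 m) ∞ M] [T2Space M] [ContMDiffVectorBundle ∞ F E (𝓡 m)]

namespace SUStructure.Connection

variable (nab : s.Connection)

theorem cov_fsmul (X : VectorField m M) (f : M → ℂ) (hf : IsSmooth (m := m) f) (e : Sec m F E)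
    (x : M) : nab.cov X (fsmul f hf e) x = dirDeriv X f x • e x + f x • nab.cov X e x :=
  nab.leibniz X f hf e x

theorem cov_zero_field (e : Sec m F E) (x : M) : nab.cov 0 e x = 0 := by
  have := nab.smul_field (fun _ => 0) 0 0 contMDiff_const (fun x => by
    change (0 : TangentSpace (𝓡 m) x) = _; rw [zero_smul]) e x
  simpa using this

theorem covC_zero_right (X : VectorField m M) (e : Sec m F E) (x : M) :
    nab.covC X 0 e x = nab.cov X e x := by
  rw [covC, cov_zero_field, smul_zero, add_zero]

theorem covC_add_section (X Y : VectorField m M) (e e' : Sec m F E) (x : M) :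
    nab.covC X Y (e + e') x = nab.covC X Y e x + nab.covC X Y e' x := by
  simp only [covC, nab.add_section, ContMDiffSection.coe_add, Pi.add_apply, smul_add]
  abel

theorem covC_volume (X Y : VectorField m M) (e : Fin n → Sec m F E) (x : M) :
    dirDeriv X (fun y => s.vol y (fun i => e i y)) x +
      Complex.I * dirDeriv Y (fun y => s.vol y (fun i => e i y)) x =
    ∑ i, s.vol x (Function.update (fun j => e j x) i (nab.covC X Y (e i) x)) := by
  rw [nab.volume, nab.volume, Finset.mul_sum, ← Finset.sum_add_distrib]
  refine Finset.sum_congr rfl fun i _ => ?_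
  rw [covC, AlternatingMap.map_update_add, AlternatingMap.map_update_smul, smul_eq_mul]

/-- Sections of `End(E)` have covariant derivatives along vector fields. -/
theorem exists_covEnd (hn : 0 < n) (hF : Module.finrank ℂ F = n) (X : VectorField m M)
    (S : EndAlg m F E) :
    ∃ T : EndAlg m F E, ∀ e, T.act e = nab.cov X (S.act e) - S.act (nab.cov X e) := by
  refine s.exists_endAlg_of_tensorial hn hF _ (fun e e' => ?_) (fun f hf e x => ?_)
  · rw [EndAlg.act_add_sec, nab.add_section, nab.add_section, EndAlg.act_add_sec]
    abel
  · simp only [ContMDiffSection.coe_sub, Pi.sub_apply, EndAlg.act_fsmul, EndAlg.act_apply,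
      cov_fsmul, map_add, map_smul, smul_sub]
    abel

theorem exists_der (hn : 0 < n) (hF : Module.finrank ℂ F = n) (X : VectorField m M) :
    ∃ D : Der (EndAlg m F E), ∀ S e,
      (D S).act e = nab.cov X (S.act e) - S.act (nab.cov X e) := by
  choose T hT using nab.exists_covEnd hn hF X
  refine ⟨⟨{ toFun := T, map_add' := fun S S' => ?_, map_smul' := fun c S => ?_ },
    fun S S' => ?_⟩, hT⟩
  · refine EndAlg.ext_act fun e => ?_
    have h : ∀ (P Q : EndAlg m F E) (e : Sec m F E), (P + Q).act e = P.act e + Q.act e :=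
      fun _ _ _ => rfl
    simp only [h, hT, nab.add_section]
    abel
  · refine EndAlg.ext_act fun e => ContMDiffSection.ext fun x => ?_
    have h : ∀ (P : EndAlg m F E) (e : Sec m F E), (c • P).act e =
      fsmul (fun _ => c) (isSmooth_const c) (P.act e) := fun _ _ => rfl
    simp only [RingHom.id_apply, h, hT, ContMDiffSection.coe_sub, Pi.sub_apply, cov_fsmul,
      dirDeriv_const, zero_smul, zero_add, fsmul_apply, smul_sub]
  · refine EndAlg.ext_act fun e => ?_
    have h : ∀ (P Q : EndAlg m F E) (e : Sec m F E), (P + Q).act e = P.act e + Q.act e :=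
      fun _ _ _ => rfl
    change (T (S * S')).act e = (T S * S' + S * T S').act e
    have h2 : ∀ a b : Sec m F E, S.act (a - b) = S.act a - S.act b := fun a b =>
      ContMDiffSection.ext fun x => map_sub (S.1 x) _ _
    simp only [h, EndAlg.act_mul, hT, h2]
    abel

/-- The derivation `∇_X` of the algebra of sections of `End(E)`. -/
def der (hn : 0 < n) (hF : Module.finrank ℂ F = n) (X : VectorField m M) : Der (EndAlg m F E) :=
  (nab.exists_der hn hF X).choose

variable (hn : 0 < n) (hF : Module.finrank ℂ F = n)

theorem der_act (X : VectorField m M) (S : EndAlg m F E) (e : Sec m F E) :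
    (nab.der hn hF X S).act e = nab.cov X (S.act e) - S.act (nab.cov X e) :=
  (nab.exists_der hn hF X).choose_spec S e

theorem der_apply (X : VectorField m M) (S : EndAlg m F E) (e : Sec m F E) (x : M) :
    (nab.der hn hF X S).1 x (e x) = nab.cov X (S.act e) x - S.1 x (nab.cov X e x) :=
  congrArg (fun z : Sec m F E => z x) (nab.der_act hn hF X S e)

theorem der_add (X Y : VectorField m M) :
    nab.der hn hF (X + Y) = nab.der hn hF X + nab.der hn hF Y :=
  Der.ext fun S => EndAlg.ext_act fun e => ContMDiffSection.ext fun x => by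
    simp only [Der.add_apply, EndAlg.act_apply, EndAlg.add_apply, der_apply, nab.add_field,
      ContMDiffSection.coe_add, Pi.add_apply, map_add]
    abel

theorem der_zero : nab.der hn hF (0 : VectorField m M) = 0 := by
  have := nab.der_add hn hF 0 0
  rwa [add_zero, left_eq_add] at this

theorem der_smul (f : M → ℝ) (hf : ContMDiff (𝓡 m) 𝓘(ℝ, ℝ) ∞ f) {X Y : VectorField m M}
    (h : ∀ x, Y x = f x • X x) (hf' : IsSmooth (m := m) (fun x => (f x : ℂ))) :
    nab.der hn hF Y = EndAlg.scalarCenter (F := F) (E := E) (fun x => (f x : ℂ)) hf' • nab.der hn hF X :=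
  Der.ext fun S => EndAlg.ext_act fun e => ContMDiffSection.ext fun x => by
    rw [Der.center_smul_apply]
    change (nab.der hn hF Y S).1 x (e x) = (f x : ℂ) • (nab.der hn hF X S).1 x (e x)
    rw [der_apply, der_apply, nab.smul_field f X Y hf h, nab.smul_field f X Y hf h, smul_sub,
      ← map_smul, Complex.coe_smul, Complex.coe_smul]

theorem der_restrictsTo (X : VectorField m M) : RestrictsTo (nab.der hn hF X) X 0 := by
  intro f hf x
  refine LinearMap.ext fun v => ?_
  obtain ⟨e, rfl⟩ := exists_section (m := m) (F := F) v
  rw [der_apply]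
  have : (EndAlg.scalar f hf).act e = fsmul f hf e := rfl
  rw [this, cov_fsmul, EndAlg.scalar_apply, add_sub_cancel_right, dirDeriv_zero_field, mul_zero,
    add_zero]
  rfl

/-- Metric compatibility is used to differentiate both sides of `⟨S e, e'⟩ = ⟨e, T e'⟩`. -/
theorem der_isReal (X : VectorField m M) : s.IsReal (nab.der hn hF X) := by
  intro S T hST x u v
  obtain ⟨e, rfl⟩ := exists_section (m := m) (F := F) u
  obtain ⟨e', rfl⟩ := exists_section (m := m) (F := F) v
  rw [der_apply, der_apply, map_sub, LinearMap.sub_apply, map_sub, hST x, ← hST x (e x)]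
  have h1 := nab.metric X (S.act e) e' x
  have h2 := nab.metric X e (T.act e') x
  have h3 : (fun y => s.inner y (S.act e y) (e' y)) = fun y => s.inner y (e y) (T.act e' y) :=
    funext fun y => hST y _ _
  rw [h3, h2] at h1
  simp only [EndAlg.act_apply] at h1 ⊢
  linear_combination -h1

end SUStructure.Connection

theorem RestrictsTo.unique {D : Der (EndAlg m F E)} {X Y X' Y' : VectorField m M}
    (hn : 0 < n) (hF : Module.finrank ℂ F = n)
    (h : RestrictsTo D X Y) (h' : RestrictsTo D X' Y') : X = X' ∧ Y = Y' := by
  refine vectorField_ext fun f hf x => ?_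
  have h1 := (h f hf x).symm.trans (h' f hf x)
  have : FiniteDimensional ℂ F := Module.finite_of_finrank_pos (by omega)
  have : Nontrivial (E x) := by
    have : 0 < Module.finrank ℂ (E x) := by rw [finrank_fiber (F := F) x]; omega
    exact Module.nontrivial_of_finrank_pos this
  obtain ⟨v, hv⟩ := exists_ne (0 : E x)
  have h2 := congrArg (fun A : Module.End ℂ (E x) => A v) h1
  exact smul_left_injective ℂ hv h2

namespace SUStructure.Connection

variable {nab : s.Connection} {α : Form1 (EndAlg m F E)} (hn : 0 < n)
  (hF : Module.finrank ℂ F = n)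

/-- `HasForm` only provides some pair of vector fields; by uniqueness any pair to which `D`
restricts will do. -/
theorem HasForm.apply (hα : nab.HasForm α) {D : Der (EndAlg m F E)} {X Y : VectorField m M}
    (h : RestrictsTo D X Y) (hn : 0 < n) (hF : Module.finrank ℂ F = n) (S : EndAlg m F E)
    (e : Sec m F E) (x : M) :
    (D S).1 x (e x) = (nab.covC X Y (S.act e) x - S.1 x (nab.covC X Y e x)) -
      (α D * S - S * α D).1 x (e x) := by
  obtain ⟨-, X', Y', h', H⟩ := hα D
  obtain ⟨rfl, rfl⟩ := h.unique hn hF h'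
  exact H S e x

theorem covC_eq_der (nab : s.Connection) (X Y : VectorField m M) (S : EndAlg m F E)
    (e : Sec m F E) (x : M) :
    nab.covC X Y (S.act e) x - S.1 x (nab.covC X Y e x) =
      ((nab.der hn hF X + Complex.I • nab.der hn hF Y) S).1 x (e x) := by
  simp only [Der.add_apply, Der.smul_apply, EndAlg.add_apply, EndAlg.smul_apply, der_apply, covC,
    map_add, map_smul, smul_sub]
  abel

theorem HasForm.der_decomp (hα : nab.HasForm α) {D : Der (EndAlg m F E)} {X Y : VectorField m M}
    (h : RestrictsTo D X Y) :
    D = nab.der hn hF X + Complex.I • nab.der hn hF Y - ad (α D) :=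
  Der.ext fun S => EndAlg.ext_act fun e => ContMDiffSection.ext fun x => by
    rw [EndAlg.act_apply, hα.apply h hn hF, covC_eq_der hn hF]
    rfl

-- An inner derivation kills functions, so its vector field is zero and the decomposition reads `ad
-- γ = -ad (α (ad γ))`. Hence `α (ad γ) + γ` is central and traceless.
include hn hF in
theorem HasForm.on_inner (hα : nab.HasForm α) {γ : EndAlg m F E} (hγ : γ.Traceless) :
    α (ad γ) = -γ := by
  have h0 : RestrictsTo (ad γ) (0 : VectorField m M) 0 := by
    intro f hf x
    rw [dirDeriv_zero_field, mul_zero, add_zero, zero_smul]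
    refine LinearMap.ext fun v => ?_
    change γ.1 x (f x • v) - f x • γ.1 x v = 0
    rw [map_smul, sub_self]
  have h1 := hα.der_decomp hn hF h0
  rw [der_zero, smul_zero, add_zero, zero_sub] at h1
  refine eq_neg_of_add_eq_zero_left
    (s.eq_zero_of_commute hn hF ((hα (ad γ)).1.add hγ) fun S => ?_)
  have h2 : γ * S - S * γ = -(α (ad γ) * S - S * α (ad γ)) :=
    congrArg (fun D : Der (EndAlg m F E) => D S) h1
  rw [add_mul, mul_add]
  have h3 : γ * S - S * γ + (α (ad γ) * S - S * α (ad γ)) = 0 := by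
    rw [h2]; abel
  rw [← sub_eq_zero, ← h3]
  abel

include hn hF in
theorem HasForm.antihermitian (hα : nab.HasForm α) {D : Der (EndAlg m F E)} (hD : s.IsReal D) :
    s.Antihermitian (α D) := by
  obtain ⟨h0, X, Y, h, -⟩ := hα D
  -- For real `f` the scalar `f` is selfadjoint, so `X f + i Y f` is real; as `X f` and `Y f` are
  -- real too, `Y f = 0`. Complex `f` are split into real and imaginary parts.
  have hY : Y = 0 := by
    have key : ∀ f : M → ℂ, IsSmooth (m := m) f → (∀ y, (f y).im = 0) → ∀ x,
        dirDeriv Y f x = 0 := by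
      intro f hf hr x
      obtain ⟨b, e, he, hb, -⟩ := s.exists_frame hn hF x
      have hadj : s.IsAdjoint (EndAlg.scalar f hf) (EndAlg.scalar f hf) := by
        intro y u v
        rw [EndAlg.scalar_apply, EndAlg.scalar_apply, map_smulₛₗ, LinearMap.smul_apply, map_smul,
          Complex.conj_eq_iff_im.2 (hr y)]
      have h1 := hD _ _ hadj x (b ⟨0, hn⟩) (b ⟨0, hn⟩)
      rw [h f hf x] at h1
      simp only [LinearMap.smul_apply, Module.End.one_apply, map_smulₛₗ, hb, if_true, smul_eq_mul,
        mul_one, RingHom.id_apply] at h1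
      have h2 := Complex.conj_eq_iff_im.1 h1
      have h3 := dirDeriv_im_eq_zero X hf hr x
      have h4 := dirDeriv_im_eq_zero Y hf hr x
      simp only [Complex.add_im, h3, Complex.I_mul_im, zero_add] at h2
      exact Complex.ext h2 h4
    refine (vectorField_ext (X := Y) (Y := 0) (X' := 0) (Y' := 0) ?_).1
    intro f hf x
    have hre : IsSmooth (m := m) (fun y => ((f y).re : ℂ)) :=
      (Complex.ofRealCLM.comp Complex.reCLM).contMDiff.comp hf
    have him : IsSmooth (m := m) (fun y => ((f y).im : ℂ)) :=
      (Complex.ofRealCLM.comp Complex.imCLM).contMDiff.comp hf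
    have hI : IsSmooth (m := m) (fun y => Complex.I * ((f y).im : ℂ)) :=
      (Complex.I • (Complex.ofRealCLM.comp Complex.imCLM)).contMDiff.comp hf
    have hf' : f = fun y => ((f y).re : ℂ) + Complex.I * ((f y).im : ℂ) := by
      funext y
      rw [mul_comm]
      exact (Complex.re_add_im _).symm
    rw [dirDeriv_zero_field]
    conv_lhs => rw [hf']
    rw [dirDeriv_add Y (hre.isDiffAt x) (hI.isDiffAt x), dirDeriv_const_mul Y _ (him.isDiffAt x),
      key _ hre (fun _ => Complex.ofReal_im _), key _ him (fun _ => Complex.ofReal_im _)]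
    simp
  subst hY
  refine antihermitian_of_isReal_ad hn hF h0 ?_
  have h1 := hα.der_decomp hn hF h
  rw [der_zero, smul_zero, add_zero] at h1
  have h2 : ad (α D) = nab.der hn hF X - D := by
    nth_rewrite 2 [h1]
    abel
  rw [h2]
  exact (nab.der_isReal hn hF X).sub hD

end SUStructure.Connection

end Connections

/-! ### Forms of connections: trace, Lie derivative, existence and uniqueness -/

section Forms

variable {m : ℕ} {M : Type*} [TopologicalSpace M] [ChartedSpace (EuclideanSpace ℝ (Fin m)) M]
  {F : Type*} [NormedAddCommGroup F] [NormedSpace ℂ F]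
  {E : M → Type*} [∀ x, AddCommGroup (E x)] [∀ x, Module ℂ (E x)]
  [TopologicalSpace (TotalSpace F E)] [∀ x, TopologicalSpace (E x)] [FiberBundle F E]
  [VectorBundle ℂ F E] [VectorBundle ℝ F E]
  {n : ℕ} {s : SUStructure m F E n}

theorem EndAlg.trace_commutator (S T : EndAlg m F E) (x : M) :
    LinearMap.trace ℂ (E x) ((S * T - T * S).1 x) = 0 := by
  have h := map_sub (LinearMap.trace ℂ (E x)) (S.1 x * T.1 x) (T.1 x * S.1 x)
  rw [LinearMap.trace_mul_comm, sub_self] at h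
  exact h

variable [IsManifold (𝓡 m) ∞ M] [T2Space M] [ContMDiffVectorBundle ∞ F E (𝓡 m)]

theorem update_section_apply (e : Fin n → Sec m F E) (i : Fin n) (y : Sec m F E) (x : M) :
    (fun j => Function.update e i y j x) = Function.update (fun j => e j x) i (y x) := by
  funext j
  by_cases h : j = i
  · subst h; simp
  · simp [h]

namespace SUStructure

theorem sum_vol_update (hn : 0 < n) (hF : Module.finrank ℂ F = n) {x : M}
    (A : Module.End ℂ (E x)) (v : Fin n → E x) :
    ∑ i, s.vol x (Function.update v i (A (v i))) = LinearMap.trace ℂ (E x) A * s.vol x v := by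
  obtain ⟨b, -⟩ := s.exists_orthonormal hn hF x
  exact sum_topForm_update b (s.vol x) A v

namespace Connection

variable {nab : s.Connection} {α α' : Form1 (EndAlg m F E)} (hn : 0 < n)
  (hF : Module.finrank ℂ F = n)

-- Differentiate `∑ i, vol(…, γ e_i, …) = tr γ · vol(e) = 0` with the volume parallel. The terms
-- with `∇` on another vector `e_j` also arise from the trace identity for the family with `e_j`
-- replaced by `∇ e_j`. Subtracting the two leaves the trace of `∇γ` times the volume.
include hn hF in
theorem trace_covC_commutator (nab : s.Connection) {γ : EndAlg m F E} (hγ : γ.Traceless)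
    (X Y : VectorField m M) {x : M} (A : Module.End ℂ (E x))
    (hA : ∀ e : Sec m F E, A (e x) = nab.covC X Y (γ.act e) x - γ.1 x (nab.covC X Y e x)) :
    LinearMap.trace ℂ (E x) A = 0 := by
  refine s.trace_eq_zero_of_vol hn hF A fun e => ?_
  let v : Fin n → E x := fun j => e j x
  let g : Fin n → E x := fun i => γ.1 x (e i x)
  let c : Fin n → E x := fun i => nab.covC X Y (e i) x
  let k : Fin n → E x := fun i => nab.covC X Y (γ.act (e i)) x
  -- The off-diagonal terms common to both double sums: `γ e_i` in slot `i` and `∇ e_j` in slot `j`.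
  let G : Fin n → Fin n → ℂ := fun i j =>
    if i = j then 0 else s.vol x (Function.update (Function.update v i (g i)) j (c j))
  have h1 : ∑ i, ∑ j, ((if i = j then s.vol x (Function.update v i (k i)) else 0) + G i j) = 0 := by
    have hV : ∀ i, ∑ j, ((if i = j then s.vol x (Function.update v i (k i)) else 0) + G i j) =
        dirDeriv X (fun y => s.vol y (Function.update (fun j => e j y) i (γ.act (e i) y))) x +
        Complex.I * dirDeriv Y
          (fun y => s.vol y (Function.update (fun j => e j y) i (γ.act (e i) y))) x := by
      intro i
      have h := nab.covC_volume X Y (Function.update e i (γ.act (e i))) x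
      simp only [update_section_apply] at h
      rw [h]
      refine Finset.sum_congr rfl fun j _ => ?_
      by_cases hij : i = j
      · subst hij
        simp [G, v, k]
      · simp only [G, if_neg hij, zero_add, v, g, c]
        rw [Function.update_of_ne (Ne.symm hij)]
        rfl
    rw [Finset.sum_congr rfl fun i _ => hV i, Finset.sum_add_distrib, ← Finset.mul_sum,
      ← (dirDeriv_sum Finset.univ X fun i =>
        (s.isSmooth_vol_update e i (γ.act (e i))).isDiffAt x).2,
      ← (dirDeriv_sum Finset.univ Y fun i =>
        (s.isSmooth_vol_update e i (γ.act (e i))).isDiffAt x).2]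
    have h0 : (fun y => ∑ i, s.vol y (Function.update (fun j => e j y) i (γ.act (e i) y))) =
        fun _ => 0 := by
      funext y
      refine (s.sum_vol_update hn hF (γ.1 y) fun j => e j y).trans ?_
      rw [hγ y, zero_mul]
    rw [h0, dirDeriv_const, dirDeriv_const, mul_zero, add_zero]
  have h2 : ∑ j, ∑ i,
      ((if i = j then s.vol x (Function.update v i (γ.1 x (c i))) else 0) + G i j) = 0 := by
    refine Finset.sum_eq_zero fun j _ => ?_
    have h := s.sum_vol_update hn hF (γ.1 x) (Function.update v j (c j))
    rw [hγ x, zero_mul] at h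
    refine (Finset.sum_congr rfl fun i _ => ?_).trans h
    by_cases hij : i = j
    · subst hij
      simp [G]
    · simp only [G, if_neg hij, zero_add]
      rw [Function.update_of_ne hij, Function.update_comm hij]
  rw [Finset.sum_comm] at h2
  simp only [Finset.sum_add_distrib, Finset.sum_ite_eq, Finset.mem_univ, if_true] at h1 h2
  have h3 : ∀ i, s.vol x (Function.update (fun j => e j x) i (A (e i x))) =
      s.vol x (Function.update v i (k i)) - s.vol x (Function.update v i (γ.1 x (c i))) := by
    intro i
    rw [hA, AlternatingMap.map_update_sub]
  rw [Finset.sum_congr rfl fun i _ => h3 i, Finset.sum_sub_distrib]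
  linear_combination h1 - h2

include hn hF in
theorem HasForm.traceless_apply (hα : nab.HasForm α) (D : Der (EndAlg m F E))
    {γ : EndAlg m F E} (hγ : γ.Traceless) : (D γ).Traceless := by
  intro x
  obtain ⟨-, X, Y, h, H⟩ := hα D
  have h1 := nab.trace_covC_commutator hn hF hγ X Y
    ((D γ + (α D * γ - γ * α D)).1 x) fun e => by
      rw [EndAlg.add_apply, H γ e x, sub_add_cancel]
  have h2 := map_add (LinearMap.trace ℂ (E x)) ((D γ).1 x) ((α D * γ - γ * α D).1 x)
  rw [EndAlg.trace_commutator, add_zero] at h2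
  exact h2.symm.trans h1

include hn hF in
theorem HasForm.isSUForm (hα : nab.HasForm α) : s.IsSUForm α :=
  ⟨fun _ hγ => hα.on_inner hn hF hγ, fun D => (hα D).1, fun _ hD => hα.antihermitian hn hF hD⟩

-- Both terms equal `-D γ`: the bracket is `ad (D γ)`, and `D γ` is again traceless.
include hn hF in
theorem HasForm.lieDeriv_ad (hα : nab.HasForm α) (D : Der (EndAlg m F E)) {γ : EndAlg m F E}
    (hγ : γ.Traceless) : lieDeriv D α (ad γ) = 0 := by
  rw [lieDeriv_apply, lie_ad, hα.on_inner hn hF hγ,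
    hα.on_inner hn hF (hα.traceless_apply hn hF D hγ), Der.map_neg, sub_self]

include hn hF in
theorem HasForm.lieDeriv_traceless (hα : nab.HasForm α) (D D' : Der (EndAlg m F E)) :
    (lieDeriv D α D').Traceless := by
  rw [lieDeriv_apply]
  exact (hα.traceless_apply hn hF D (hα D').1).sub (hα _).1

include hn hF in
theorem HasForm.lieDeriv_antihermitian (hα : nab.HasForm α) {D D' : Der (EndAlg m F E)}
    (hD : s.IsReal D) (hD' : s.IsReal D') : s.Antihermitian (lieDeriv D α D') := by
  have h1 := hD _ _ (hα.antihermitian hn hF hD')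
  have h2 := hα.antihermitian hn hF (hD.lie hD')
  have h3 := h1.sub h2
  rw [lieDeriv_apply, Antihermitian]
  rw [Der.map_neg] at h3
  convert h3 using 1
  abel

include hn hF in
theorem HasForm.isSUForm_add_lieDeriv (hα : nab.HasForm α) {D : Der (EndAlg m F E)}
    (hD : s.IsReal D) : s.IsSUForm (α + lieDeriv D α) where
  on_inner γ hγ := by
    rw [LinearMap.add_apply, hα.lieDeriv_ad hn hF D hγ, hα.on_inner hn hF hγ, add_zero]
  traceless D' := (hα D').1.add (hα.lieDeriv_traceless hn hF D D')
  antihermitian D' hD' := by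
    have h := (hα.antihermitian hn hF hD').add (hα.lieDeriv_antihermitian hn hF hD hD')
    rw [Antihermitian, LinearMap.add_apply, neg_add]
    exact h

/-- The sum of a connection and a 1-form with traceless antihermitian values. -/
theorem exists_add (nab : s.Connection) (hn : 0 < n) (hF : Module.finrank ℂ F = n)
    (B : VectorField m M → EndAlg m F E) (hadd : ∀ X Y, B (X + Y) = B X + B Y)
    (hsmul : ∀ (f : M → ℝ) (X Y : VectorField m M), ContMDiff (𝓡 m) 𝓘(ℝ, ℝ) ∞ f →
      (∀ x, Y x = f x • X x) → ∀ x v, (B Y).1 x v = f x • (B X).1 x v)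
    (htr : ∀ X, (B X).Traceless) (hanti : ∀ X, s.Antihermitian (B X)) :
    ∃ nab' : s.Connection, ∀ X e, nab'.cov X e = nab.cov X e + (B X).act e := by
  refine ⟨⟨fun X e => nab.cov X e + (B X).act e, fun X Y e => ?_, fun f X Y hf h e x => ?_,
    fun X e e' => ?_, fun X f hf e x => ?_, fun X e e' x => ?_, fun X e x => ?_⟩, fun _ _ => rfl⟩
  · rw [nab.add_field, hadd]
    have : (B X + B Y).act e = (B X).act e + (B Y).act e := rfl
    rw [this]
    abel
  · change nab.cov Y e x + (B Y).1 x (e x) = f x • (nab.cov X e x + (B X).1 x (e x))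
    rw [nab.smul_field f X Y hf h, hsmul f X Y hf h, smul_add]
  · rw [nab.add_section, EndAlg.act_add_sec]
    abel
  · change nab.cov X (fsmul f hf e) x + (B X).1 x (f x • e x) =
      _ + f x • (nab.cov X e x + (B X).1 x (e x))
    rw [nab.leibniz, map_smul, smul_add, add_assoc]
  · change _ = s.inner x (nab.cov X e x + (B X).1 x (e x)) (e' x) +
      s.inner x (e x) (nab.cov X e' x + (B X).1 x (e' x))
    rw [nab.metric, map_add, map_add, LinearMap.add_apply, hanti X x, EndAlg.neg_apply, map_neg]
    ring
  · change _ = ∑ i, s.vol x (Function.update (fun j => e j x) i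
      (nab.cov X (e i) x + (B X).1 x (e i x)))
    simp only [AlternatingMap.map_update_add, Finset.sum_add_distrib]
    rw [nab.volume, s.sum_vol_update hn hF, htr X x, zero_mul, add_zero]

/-- Comparison of the forms of two connections. -/
theorem HasForm.of_covC {nab' : s.Connection} (hα : nab.HasForm α) (hn : 0 < n)
    (hF : Module.finrank ℂ F = n)
    (h : ∀ D X Y, RestrictsTo D X Y → ∀ (e : Sec m F E) x,
      nab'.covC X Y e x = nab.covC X Y e x + (α' D - α D).1 x (e x)) : nab'.HasForm α' := by
  intro D
  obtain ⟨h0, X, Y, hXY, H⟩ := hα D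
  refine ⟨fun x => ?_, X, Y, hXY, fun S e x => ?_⟩
  · have h1 : LinearMap.trace ℂ (E x) ((α' D - α D).1 x) = 0 := by
      refine s.trace_eq_zero_of_vol hn hF _ fun e => ?_
      have h2 := nab.covC_volume X Y e x
      rw [nab'.covC_volume X Y e x] at h2
      simp only [h D X Y hXY, AlternatingMap.map_update_add, Finset.sum_add_distrib] at h2
      exact add_eq_left.1 h2
    have h2 := map_sub (LinearMap.trace ℂ (E x)) ((α' D).1 x) ((α D).1 x)
    rw [h0 x, sub_zero] at h2
    exact h2.symm.trans h1
  · rw [H, h D X Y hXY, h D X Y hXY]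
    simp only [EndAlg.sub_apply, EndAlg.mul_apply, map_add, map_sub, EndAlg.act_apply]
    abel

-- The difference `δ` of the two covariant derivatives is function linear and commutes with all
-- endomorphisms, so it is a scalar `c`. Comparing the derivatives of the volume of a frame gives `n
-- c = 0`.
include hn hF in
theorem HasForm.cov_unique {nab' : s.Connection} (hα : nab.HasForm α) (hα' : nab'.HasForm α) :
    nab = nab' := by
  refine Connection.ext (funext fun X => funext fun e₀ => ContMDiffSection.ext fun x => ?_)
  let δ : Sec m F E → E x := fun e => nab.cov X e x - nab'.cov X e x
  have hr := nab.der_restrictsTo hn hF X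
  have hcomm : ∀ (S : EndAlg m F E) e, δ (S.act e) = S.1 x (δ e) := by
    intro S e
    have h1 := (hα.apply hr hn hF S e x).symm.trans (hα'.apply hr hn hF S e x)
    simp only [covC_zero_right] at h1
    have h2 := sub_left_injective h1
    simp only [δ, map_sub]
    rw [sub_eq_sub_iff_add_eq_add] at h2 ⊢
    rw [h2, add_comm]
  have hfsmul : ∀ f (hf : IsSmooth (m := m) f) e, δ (fsmul f hf e) = f x • δ e := by
    intro f hf e
    simp only [δ, cov_fsmul, smul_sub]
    abel
  obtain ⟨b, e, he, hb, hv⟩ := s.exists_frame hn hF x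
  let o : Fin n := ⟨0, hn⟩
  let c : ℂ := s.inner x (b o) (δ (e o))
  have key : ∀ w, δ w = c • w x := by
    intro w
    have h1 := hcomm (s.rankOne (e o) w) (e o)
    rw [rankOne_act, hfsmul, rankOne_apply, he, hb, if_pos rfl, one_smul] at h1
    exact h1
  have h1 := nab.volume X e x
  rw [nab'.volume X e x] at h1
  have h2 : ∀ i, nab.cov X (e i) x = nab'.cov X (e i) x + c • e i x := fun i => by
    rw [← key]
    simp only [δ]
    abel
  simp only [h2, AlternatingMap.map_update_add, Finset.sum_add_distrib,
    AlternatingMap.map_update_smul] at h1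
  have h3 : ∀ i, Function.update (fun j => e j x) i (e i x) = fun j => e j x := fun i =>
    Function.update_eq_self i (fun j => e j x)
  simp only [h3, Finset.sum_const, Finset.card_univ, Fintype.card_fin, nsmul_eq_mul, smul_eq_mul,
    left_eq_add, mul_eq_zero, hv, or_false, Nat.cast_eq_zero] at h1
  have hc : c = 0 := h1.resolve_left hn.ne'
  have := key e₀
  rw [hc, zero_smul] at this
  exact sub_eq_zero.1 this

include hn hF in
/-- The form of an `SU(n)`-connection can be replaced by any other form with the characteristic
properties. -/
theorem HasForm.existsUnique (hα : nab.HasForm α) (hα' : s.IsSUForm α') :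
    ∃! nab' : s.Connection, nab'.HasForm α' := by
  let β : Form1 (EndAlg m F E) := α' - α
  have hs := hα.isSUForm hn hF
  obtain ⟨nab', h'⟩ := nab.exists_add hn hF (fun X => β (nab.der hn hF X))
    (fun X Y => by rw [der_add, map_add])
    (fun f X Y hf h x v => by
      have hf' : IsSmooth (m := m) (fun x => (f x : ℂ)) := Complex.ofRealCLM.contMDiff.comp hf
      rw [nab.der_smul hn hF f hf h hf', Form1.map_center_smul, ← Complex.coe_smul]
      rfl)
    (fun X => (hα'.traceless _).sub (hs.traceless _))
    (fun X => by
      have h := (hα'.antihermitian _ (nab.der_isReal hn hF X)).sub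
        (hs.antihermitian _ (nab.der_isReal hn hF X))
      rw [Antihermitian, LinearMap.sub_apply, neg_sub']
      exact h)
  refine ⟨nab', hα.of_covC hn hF fun D X Y hXY e x => ?_, fun nab'' h'' =>
    (h''.cov_unique hn hF (hα.of_covC hn hF fun D X Y hXY e x => ?_))⟩
  all_goals
    -- `β` vanishes on `ad (α D)`, where both forms take the value `-α D`, so only the vector field
    -- part of `D` contributes.
    have h1 : α' D - α D = β (nab.der hn hF X) + Complex.I • β (nab.der hn hF Y) := by
      change β D = _
      have h2 : β (ad (α D)) = 0 := by
        rw [LinearMap.sub_apply, hα'.on_inner _ (hα D).1, hs.on_inner _ (hα D).1, sub_self]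
      conv_lhs => rw [hα.der_decomp hn hF hXY]
      rw [map_sub, h2, sub_zero, map_add, Form1.map_complex_smul]
    rw [h1, covC, covC, h', h']
    simp only [ContMDiffSection.coe_add, Pi.add_apply, EndAlg.act_apply, EndAlg.add_apply,
      EndAlg.smul_apply, smul_add]
    abel

end Connection

/-- The trace of a section of `End(E)` is smooth. -/
theorem isSmooth_trace (s : SUStructure m F E n) (hn : 0 < n) (hF : Module.finrank ℂ F = n)
    (η : EndAlg m F E) : IsSmooth (m := m) (fun x => LinearMap.trace ℂ (E x) (η.1 x)) := by
  intro x
  obtain ⟨b, e, -, -, hv⟩ := s.exists_frame hn hF x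
  -- Near `x` the trace is the quotient of `∑ i, vol(…, η e_i, …)` by `vol(e)`.
  have h1 : ContMDiffAt (𝓡 m) 𝓘(ℝ, ℂ) ∞ (fun y => (s.vol y fun i => e i y)⁻¹) x :=
    ContMDiffAt.comp x (contDiffAt_inv ℝ hv).contMDiffAt (s.vol_smooth e x)
  have h2 : ContMDiff (𝓡 m) 𝓘(ℝ, ℂ) ∞ (fun y => ∑ i,
      s.vol y (Function.update (fun j => e j y) i (η.act (e i) y))) :=
    contMDiff_finsetSum fun i _ => s.isSmooth_vol_update e i (η.act (e i))
  have h3 := (contDiff_mul (𝕜 := ℝ) (𝔸 := ℂ) (n := ∞)).contMDiff.contMDiffAt.comp x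
    ((h2 x).prodMk_space h1)
  refine h3.congr_of_eventuallyEq ?_
  have hcont := (s.vol_smooth e x).continuousAt
  filter_upwards [hcont.eventually_ne hv] with y hy
  change _ = (∑ i, s.vol y (Function.update (fun j => e j y) i (η.1 y (e i y)))) *
    (s.vol y fun i => e i y)⁻¹
  rw [s.sum_vol_update hn hF, mul_inv_cancel_right₀ hy]

/-- Subtracting the central section `(tr η / n) 𝟙` does not change the inner derivation; two
traceless choices differ by a central traceless section. -/
theorem existsUnique_traceless (hn : 0 < n) (hF : Module.finrank ℂ F = n) {η : EndAlg m F E}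
    (h : s.IsReal (ad η)) :
    ∃! ξ : EndAlg m F E, ξ.Traceless ∧ s.Antihermitian ξ ∧ ad ξ = ad η := by
  have hn0 : (n : ℂ) ≠ 0 := by exact_mod_cast hn.ne'
  let ζ : EndAlg m F E := (n : ℂ)⁻¹ • EndAlg.scalar _ (s.isSmooth_trace hn hF η)
  have hζ : ∀ x, ζ.1 x = ((n : ℂ)⁻¹ * LinearMap.trace ℂ (E x) (η.1 x)) • LinearMap.id := by
    intro x
    rw [mul_smul]
    rfl
  have htr : (η - ζ).Traceless := by
    intro x
    have : FiniteDimensional ℂ F := Module.finite_of_finrank_pos (by omega)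
    have := finiteDimensional_fiber (F := F) (E := E) x
    refine (map_sub (LinearMap.trace ℂ (E x)) (η.1 x) (ζ.1 x)).trans ?_
    rw [hζ, map_smul, LinearMap.trace_id, finrank_fiber (F := F), hF, smul_eq_mul]
    field_simp
    ring
  have had : ad (η - ζ) = ad η := Der.ext fun S => EndAlg.ext_fiber fun x v => by
    simp only [ad_apply, EndAlg.sub_apply, EndAlg.mul_apply, hζ, LinearMap.smul_apply,
      LinearMap.id_apply, map_sub, map_smul]
    abel
  refine ⟨η - ζ, ⟨htr, antihermitian_of_isReal_ad hn hF htr (by rwa [had]), had⟩, ?_⟩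
  rintro ξ ⟨h1, -, h2⟩
  refine sub_eq_zero.1 (s.eq_zero_of_commute hn hF (h1.sub htr) fun S => ?_)
  have h3 : ad (ξ - (η - ζ)) = 0 := by rw [ad_sub, h2, had, sub_self]
  exact sub_eq_zero.1 (congrArg (fun D : Der (EndAlg m F E) => D S) h3)

end SUStructure

end Forms

/-! ### The matrix exponential -/

section MatrixExp

variable {n : ℕ}

/-- The exponential of a matrix, as a function of the family of its entries. -/
def entryExp (i j : Fin n) (p : Fin n → Fin n → ℂ) : ℂ := NormedSpace.exp (Matrix.of p) i j

/-- The matrix with given entries, as a linear map. -/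
def ofLinear (n : ℕ) : (Fin n → Fin n → ℂ) →ₗ[ℝ] Matrix (Fin n) (Fin n) ℂ where
  toFun := Matrix.of
  map_add' _ _ := rfl
  map_smul' _ _ := rfl

-- The operator norm is only auxiliary: linear maps between families of entries and matrices are
-- continuous in finite dimension.
open scoped Matrix.Norms.Operator in
theorem contDiff_entryExp (i j : Fin n) : ContDiff ℝ ∞ (entryExp i j) := by
  have h1 : ContDiff ℝ ∞ (NormedSpace.exp : Matrix (Fin n) (Fin n) ℂ → _) :=
    contDiff_iff_contDiffAt.2 fun x => (NormedSpace.exp_analytic (𝕂 := ℝ) x).contDiffAt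
  have h2 : ContDiff ℝ ∞ (ofLinear n) := (LinearMap.toContinuousLinearMap (ofLinear n)).contDiff
  have h3 : ContDiff ℝ ∞ (Matrix.entryLinearMap ℝ ℂ i j) :=
    (LinearMap.toContinuousLinearMap (Matrix.entryLinearMap ℝ ℂ i j)).contDiff
  exact h3.comp (h1.comp h2)

theorem entryExp_zero (i j : Fin n) : entryExp i j 0 = if i = j then 1 else 0 := by
  have : (Matrix.of (0 : Fin n → Fin n → ℂ)) = 0 := rfl
  rw [entryExp, this, NormedSpace.exp_zero, Matrix.one_apply]

open scoped Matrix.Norms.Operator in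
theorem fderiv_entryExp_zero (i j : Fin n) (p : Fin n → Fin n → ℂ) :
    fderiv ℝ (entryExp i j) 0 p = p i j := by
  have h1 : HasFDerivAt (NormedSpace.exp : Matrix (Fin n) (Fin n) ℂ → _)
      (1 : Matrix (Fin n) (Fin n) ℂ →L[ℝ] _) (LinearMap.toContinuousLinearMap (ofLinear n) 0) := by
    rw [map_zero]
    exact hasFDerivAt_exp_zero
  have h2 := (LinearMap.toContinuousLinearMap (Matrix.entryLinearMap ℝ ℂ i j)).hasFDerivAt.comp 0
    (h1.comp 0 (LinearMap.toContinuousLinearMap (ofLinear n)).hasFDerivAt)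
  have h3 : HasFDerivAt (entryExp i j) _ (0 : Fin n → Fin n → ℂ) := h2
  rw [h3.fderiv]
  rfl

/-- By the spectral theorem for the hermitian matrix `i a`, `a` is conjugate to a diagonal matrix;
the determinant of its exponential is then the exponential of its trace. -/
theorem det_exp_of_skewHermitian {a : Matrix (Fin n) (Fin n) ℂ} (ha : a.conjTranspose = -a)
    (htr : a.trace = 0) : (NormedSpace.exp a).det = 1 := by
  have hH : (Complex.I • a).IsHermitian := by
    rw [Matrix.IsHermitian, Matrix.conjTranspose_smul, ha]
    simp
  let u := hH.eigenvectorUnitary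
  let U : (Matrix (Fin n) (Fin n) ℂ)ˣ := Unitary.toUnits u
  let d : Fin n → ℂ := fun i => -Complex.I * (hH.eigenvalues i : ℂ)
  have h1 : a = U * Matrix.diagonal d * (U⁻¹ : (Matrix (Fin n) (Fin n) ℂ)ˣ) := by
    have h2 := hH.spectral_theorem
    rw [Unitary.conjStarAlgAut_apply] at h2
    have h3 : a = (-Complex.I) • (Complex.I • a) := by
      rw [smul_smul]; simp
    have h4 : Matrix.diagonal d = (-Complex.I) •
        Matrix.diagonal ((RCLike.ofReal : ℝ → ℂ) ∘ hH.eigenvalues) := by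
      rw [← Matrix.diagonal_smul]; rfl
    rw [h4, mul_smul_comm, smul_mul_assoc]
    refine h3.trans ?_
    congr 1
  have h5 : ∑ i, d i = 0 := by
    rw [← Matrix.trace_diagonal, ← htr]
    conv_rhs => rw [h1, Matrix.trace_mul_comm, ← mul_assoc, Units.inv_mul, one_mul]
  rw [h1, Matrix.exp_units_conj, Matrix.det_units_conj, Matrix.exp_diagonal, Matrix.det_diagonal]
  have h6 : ∀ i, NormedSpace.exp d i = Complex.exp (d i) := fun i => by
    rw [Pi.coe_exp, Complex.exp_eq_exp_ℂ]
  rw [Finset.prod_congr rfl fun i _ => h6 i, ← Complex.exp_sum, h5, Complex.exp_zero]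

end MatrixExp

/-! ### The exponential of an endomorphism in a basis -/

section EndExp

variable {V : Type*} [AddCommGroup V] [Module ℂ V] {n : ℕ}

/-- The exponential of an endomorphism, computed in a basis. -/
def expEnd (b : Module.Basis (Fin n) ℂ V) (A : Module.End ℂ V) : Module.End ℂ V :=
  Matrix.toLinAlgEquiv b (NormedSpace.exp (LinearMap.toMatrixAlgEquiv b A))

theorem toMatrix_expEnd (b : Module.Basis (Fin n) ℂ V) (A : Module.End ℂ V) :
    LinearMap.toMatrixAlgEquiv b (expEnd b A) = NormedSpace.exp (LinearMap.toMatrixAlgEquiv b A) :=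
  LinearMap.toMatrixAlgEquiv_toLinAlgEquiv b _

/-- The matrix exponential commutes with conjugation. This permits orthonormal bases for unitarity
and moving frames for smoothness. -/
theorem expEnd_eq (b b' : Module.Basis (Fin n) ℂ V) (A : Module.End ℂ V) :
    expEnd b A = expEnd b' A := by
  let U : (Matrix (Fin n) (Fin n) ℂ)ˣ := ⟨b'.toMatrix b, b.toMatrix b',
    b'.toMatrix_mul_toMatrix_flip b, b.toMatrix_mul_toMatrix_flip b'⟩
  have h : ∀ B : Module.End ℂ V, LinearMap.toMatrixAlgEquiv b' B =
      U * LinearMap.toMatrixAlgEquiv b B * (U⁻¹ : (Matrix (Fin n) (Fin n) ℂ)ˣ) := fun B =>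
    (basis_toMatrix_mul_linearMap_toMatrix_mul_basis_toMatrix b' b b' b B).symm
  apply (LinearMap.toMatrixAlgEquiv b').injective
  rw [toMatrix_expEnd, h, h, toMatrix_expEnd, Matrix.exp_units_conj]

theorem expEnd_mul_expEnd_neg (b : Module.Basis (Fin n) ℂ V) (A : Module.End ℂ V) :
    expEnd b A * expEnd b (-A) = 1 := by
  rw [expEnd, expEnd, ← map_mul, map_neg,
    ← Matrix.exp_add_of_commute _ _ (Commute.neg_right (Commute.refl
      (LinearMap.toMatrixAlgEquiv b A))), add_neg_cancel,
    NormedSpace.exp_zero, map_one]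

theorem expEnd_apply (b : Module.Basis (Fin n) ℂ V) (A : Module.End ℂ V) (v : V) :
    expEnd b A v =
      ∑ i, ∑ j, (entryExp i j (fun i j => b.repr (A (b j)) i) * b.repr v j) • b i := by
  have h1 : LinearMap.toMatrixAlgEquiv b A = Matrix.of fun i j => b.repr (A (b j)) i :=
    Matrix.ext fun i j => LinearMap.toMatrixAlgEquiv_apply b A i j
  conv_lhs => rw [← b.sum_repr v, map_sum]
  rw [Finset.sum_comm]
  refine Finset.sum_congr rfl fun j _ => ?_
  rw [map_smul, expEnd, Matrix.toLinAlgEquiv_self, Finset.smul_sum, h1]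
  refine Finset.sum_congr rfl fun i _ => ?_
  rw [smul_smul, mul_comm]
  rfl

theorem sum_repr_smul (b : Module.Basis (Fin n) ℂ V) (A : Module.End ℂ V) (v : V) :
    A v = ∑ i, ∑ j, (b.repr (A (b j)) i * b.repr v j) • b i := by
  conv_lhs => rw [← b.sum_repr v, map_sum]
  rw [Finset.sum_comm]
  refine Finset.sum_congr rfl fun j _ => ?_
  rw [map_smul]
  conv_lhs => rw [← b.sum_repr (A (b j)), Finset.smul_sum]
  refine Finset.sum_congr rfl fun i _ => ?_
  rw [smul_smul, mul_comm]

/-- A family on which a top degree form does not vanish is a basis. -/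
theorem exists_basis_of_topForm (hn : 0 < n) (hV : Module.finrank ℂ V = n)
    (τ : V [⋀^Fin n]→ₗ[ℂ] ℂ) (v : Fin n → V) (h : τ v ≠ 0) :
    ∃ b : Module.Basis (Fin n) ℂ V, ⇑b = v ∧
      ∀ w i, b.repr w i = τ (Function.update v i w) * (τ v)⁻¹ := by
  have : Nonempty (Fin n) := ⟨⟨0, hn⟩⟩
  have hli : LinearIndependent ℂ v := by
    by_contra hc
    exact h (τ.map_linearDependent v hc)
  let b := basisOfLinearIndependentOfCardEqFinrank hli (by rw [hV, Fintype.card_fin])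
  have hb : ⇑b = v := coe_basisOfLinearIndependentOfCardEqFinrank _ _
  refine ⟨b, hb, fun w i => ?_⟩
  have h1 := congrArg (fun z => b.repr z i) (topForm_smul b τ v w)
  simp only [map_smul, map_sum, Finsupp.smul_apply, Finsupp.finsetSum_apply, smul_eq_mul] at h1
  have h2 : ∀ j, b.repr (v j) i = if j = i then 1 else 0 := fun j => by
    rw [← hb, Module.Basis.repr_self, Finsupp.single_apply]
  simp only [h2, mul_ite, mul_one, mul_zero, Finset.sum_ite_eq', Finset.mem_univ, if_true] at h1
  rw [← h1]
  field_simp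

end EndExp

/-! ### Smoothness of the fiberwise exponential -/

section BundleExp

variable {m : ℕ} {M : Type*} [TopologicalSpace M] [ChartedSpace (EuclideanSpace ℝ (Fin m)) M]
  {F : Type*} [NormedAddCommGroup F] [NormedSpace ℂ F]
  {E : M → Type*} [∀ x, AddCommGroup (E x)] [∀ x, Module ℂ (E x)]
  [TopologicalSpace (TotalSpace F E)] [∀ x, TopologicalSpace (E x)] [FiberBundle F E]
  [VectorBundle ℂ F E] [VectorBundle ℝ F E]
  {n : ℕ} {s : SUStructure m F E n}

/-- `U` is the fiberwise exponential of `ξ`. -/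
def IsExpOf (n : ℕ) (ξ U : EndAlg m F E) : Prop :=
  ∀ x (b : Module.Basis (Fin n) ℂ (E x)), U.1 x = expEnd b (ξ.1 x)

theorem contMDiffAt_smul_section {f : M → ℂ} {x : M} (hf : ContMDiffAt (𝓡 m) 𝓘(ℝ, ℂ) ∞ f x)
    (e : Sec m F E) :
    ContMDiffAt (𝓡 m) ((𝓡 m).prod 𝓘(ℝ, F)) ∞ (fun y => TotalSpace.mk' F y (f y • e y)) x := by
  have he := e.contMDiff x
  rw [contMDiffAt_section] at he ⊢
  refine ((contDiff_smul (𝕜 := ℝ)).contMDiff.contMDiffAt.comp x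
    (hf.prodMk_space he)).congr_of_eventuallyEq ?_
  filter_upwards [(trivializationAt F E x).open_baseSet.mem_nhds
    (FiberBundle.mem_baseSet_trivializationAt' x)] with y hy
  exact ((trivializationAt F E x).linear ℂ hy).2 (f y) (e y)

theorem contMDiffAt_mul {f g : M → ℂ} {x : M} (hf : ContMDiffAt (𝓡 m) 𝓘(ℝ, ℂ) ∞ f x)
    (hg : ContMDiffAt (𝓡 m) 𝓘(ℝ, ℂ) ∞ g x) :
    ContMDiffAt (𝓡 m) 𝓘(ℝ, ℂ) ∞ (fun y => f y * g y) x :=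
  (contDiff_mul (𝕜 := ℝ) (𝔸 := ℂ) (n := ∞)).contMDiff.contMDiffAt.comp x (hf.prodMk_space hg)

namespace SUStructure

variable (s) in
/-- The coordinates of a section in a frame. -/
def coord (e : Fin n → Sec m F E) (i : Fin n) (y : Sec m F E) (x : M) : ℂ :=
  s.vol x (Function.update (fun j => e j x) i (y x)) * (s.vol x fun j => e j x)⁻¹

variable (s) in
/-- The matrix of a section of `End(E)` in a frame. -/
def coordMatrix (e : Fin n → Sec m F E) (ξ : EndAlg m F E) (x : M) (i j : Fin n) : ℂ :=
  s.coord e i (ξ.act (e j)) x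

variable [IsManifold (𝓡 m) ∞ M] [T2Space M] [ContMDiffVectorBundle ∞ F E (𝓡 m)]

theorem contMDiffAt_coord {e : Fin n → Sec m F E} {x : M} (hv : (s.vol x fun i => e i x) ≠ 0)
    (i : Fin n) (y : Sec m F E) : ContMDiffAt (𝓡 m) 𝓘(ℝ, ℂ) ∞ (s.coord e i y) x :=
  contMDiffAt_mul (s.isSmooth_vol_update e i y x)
    (ContMDiffAt.comp x (contDiffAt_inv ℝ hv).contMDiffAt (s.vol_smooth e x))

theorem contMDiffAt_coordMatrix {e : Fin n → Sec m F E} {x : M}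
    (hv : (s.vol x fun i => e i x) ≠ 0) (ξ : EndAlg m F E) :
    ContMDiffAt (𝓡 m) 𝓘(ℝ, Fin n → Fin n → ℂ) ∞ (s.coordMatrix e ξ) x :=
  contMDiffAt_pi_space.2 fun i => contMDiffAt_pi_space.2 fun j => contMDiffAt_coord hv i _

theorem eventually_vol_ne_zero {e : Fin n → Sec m F E} {x : M}
    (hv : (s.vol x fun i => e i x) ≠ 0) : ∀ᶠ y in 𝓝 x, (s.vol y fun i => e i y) ≠ 0 :=
  (s.vol_smooth e x).continuousAt.eventually_ne hv

theorem exists_basis_of_frame (s : SUStructure m F E n) (hn : 0 < n)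
    (hF : Module.finrank ℂ F = n) {e : Fin n → Sec m F E} {x : M}
    (hv : (s.vol x fun i => e i x) ≠ 0) :
    ∃ b : Module.Basis (Fin n) ℂ (E x), (∀ i, b i = e i x) ∧
      ∀ (y : Sec m F E) i, b.repr (y x) i = s.coord e i y x := by
  obtain ⟨b, hb, h⟩ := exists_basis_of_topForm hn ((finrank_fiber (F := F) x).trans hF) (s.vol x)
    _ hv
  exact ⟨b, fun i => congrFun hb i, fun y i => h (y x) i⟩

/-- The exponential of a section of `End(E)`. -/
theorem exists_isExpOf (s : SUStructure m F E n) (hn : 0 < n) (hF : Module.finrank ℂ F = n) (ξ : EndAlg m F E) :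
    ∃ U : EndAlg m F E, IsExpOf n ξ U := by
  choose b₀ e₀ he₀ hb₀ hv₀ using s.exists_frame hn hF
  refine ⟨⟨fun x => expEnd (b₀ x) (ξ.1 x), fun y x => ?_⟩, fun x b => expEnd_eq _ _ _⟩
  let e := e₀ x
  have hv := hv₀ x
  have h1 : ∀ i j, ContMDiffAt (𝓡 m) 𝓘(ℝ, ℂ) ∞
      (fun z => entryExp i j (s.coordMatrix e ξ z) * s.coord e j y z) x := fun i j =>
    contMDiffAt_mul ((contDiff_entryExp i j).contMDiff.contMDiffAt.comp x
      (contMDiffAt_coordMatrix hv ξ)) (contMDiffAt_coord hv j y)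
  have h2 := ContMDiffAt.sum_section (s := (Finset.univ : Finset (Fin n))) fun i _ =>
    ContMDiffAt.sum_section (s := (Finset.univ : Finset (Fin n))) fun j _ =>
      contMDiffAt_smul_section (h1 i j) (e i)
  refine h2.congr_of_eventuallyEq ?_
  -- The basis `b₀ z` varies arbitrarily with `z`; basis independence replaces it by the smooth
  -- frame fixed at `x`.
  filter_upwards [eventually_vol_ne_zero hv] with z hz
  obtain ⟨b, hb, hr⟩ := s.exists_basis_of_frame hn hF hz
  rw [expEnd_eq (b₀ z) b, expEnd_apply]
  simp only [hb, hr, ← EndAlg.act_apply]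
  rfl

end SUStructure

end BundleExp

/-! ### Exponentials as gauge group elements, and gauge transforms -/

section Gauge

variable {m : ℕ} {M : Type*} [TopologicalSpace M] [ChartedSpace (EuclideanSpace ℝ (Fin m)) M]
  {F : Type*} [NormedAddCommGroup F] [NormedSpace ℂ F]
  {E : M → Type*} [∀ x, AddCommGroup (E x)] [∀ x, Module ℂ (E x)]
  [TopologicalSpace (TotalSpace F E)] [∀ x, TopologicalSpace (E x)] [FiberBundle F E]
  [VectorBundle ℂ F E] [VectorBundle ℝ F E]
  {n : ℕ} {s : SUStructure m F E n}

-- The fiber carries a topology but no norm, so continuity is transported from the model fiber.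
include F in
theorem continuous_of_linear {V : Type*} [NormedAddCommGroup V] [NormedSpace ℂ V]
    [FiniteDimensional ℂ V] {x : M} (φ : V →ₗ[ℂ] E x) : Continuous φ := by
  have h := LinearMap.continuous_of_finiteDimensional
    ((fiberEquiv F E x).toLinearEquiv.toLinearMap ∘ₗ φ)
  have h2 := (fiberEquiv F E x).symm.continuous.comp h
  convert h2 using 1
  funext v
  exact ((fiberEquiv F E x).symm_apply_apply (φ v)).symm

include F in
theorem tendsto_of_repr {x : M} (b : Module.Basis (Fin n) ℂ (E x)) {ι : Type*} {l : Filter ι}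
    {f : ι → E x} {v : E x}
    (h : ∀ i, Filter.Tendsto (fun t => b.repr (f t) i) l (𝓝 (b.repr v i))) :
    Filter.Tendsto f l (𝓝 v) := by
  have h1 := ((continuous_of_linear (F := F) b.equivFun.symm.toLinearMap).tendsto
    (b.equivFun v)).comp (tendsto_pi_nhds.2 h)
  have h2 : b.equivFun.symm.toLinearMap (b.equivFun v) = v := b.equivFun.symm_apply_apply v
  rw [h2] at h1
  refine h1.congr fun t => b.equivFun.symm_apply_apply (f t)

open scoped Matrix.Norms.Operator in
theorem IsExpOf.isExp (s : SUStructure m F E n) (hn : 0 < n) (hF : Module.finrank ℂ F = n) {t : ℝ}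
    {ξ U : EndAlg m F E} (hU : IsExpOf n ((t : ℂ) • ξ) U) : IsExp t ξ U := by
  intro x v
  obtain ⟨b, -⟩ := s.exists_orthonormal hn hF x
  let φ : Matrix (Fin n) (Fin n) ℂ →ₗ[ℂ] E x :=
    (LinearMap.applyₗ v) ∘ₗ (Matrix.toLinAlgEquiv b).toLinearMap
  have h1 := (NormedSpace.exp_series_hasSum_exp' (𝕂 := ℂ)
    (LinearMap.toMatrixAlgEquiv b ((t : ℂ) • ξ.1 x))).map φ (continuous_of_linear (F := F) φ)
  have h2 : φ (NormedSpace.exp (LinearMap.toMatrixAlgEquiv b ((t : ℂ) • ξ.1 x))) = U.1 x v := by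
    rw [hU x b]
    rfl
  rw [← h2]
  convert h1 using 1
  · funext k
    change _ = Matrix.toLinAlgEquiv b (((k.factorial : ℂ))⁻¹ •
      (LinearMap.toMatrixAlgEquiv b ((t : ℂ) • ξ.1 x)) ^ k) v
    rw [map_smul, map_pow, Matrix.toLinAlgEquiv_toMatrixAlgEquiv, smul_pow, smul_smul]
    rfl
  · rfl

theorem IsExpOf.mul_eq_one (s : SUStructure m F E n) (hn : 0 < n) (hF : Module.finrank ℂ F = n)
    {ξ U W : EndAlg m F E} (hU : IsExpOf n ξ U) (hW : IsExpOf n (-ξ) W) : U * W = 1 := by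
  refine EndAlg.ext_fiber fun x v => ?_
  obtain ⟨b, -⟩ := s.exists_orthonormal hn hF x
  have := congrArg (fun A : Module.End ℂ (E x) => A v) (expEnd_mul_expEnd_neg b (ξ.1 x))
  rw [EndAlg.mul_apply, hU x b, hW x b]
  exact this

namespace SUStructure

theorem toMatrix_eq_inner {x : M} {b : Module.Basis (Fin n) ℂ (E x)}
    (hb : ∀ i j, s.inner x (b i) (b j) = if i = j then 1 else 0) (A : Module.End ℂ (E x))
    (i j : Fin n) : LinearMap.toMatrixAlgEquiv b A i j = s.inner x (b i) (A (b j)) := by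
  rw [LinearMap.toMatrixAlgEquiv_apply, repr_eq_inner hb]

theorem conjTranspose_toMatrix {x : M} {b : Module.Basis (Fin n) ℂ (E x)}
    (hb : ∀ i j, s.inner x (b i) (b j) = if i = j then 1 else 0) {ξ : EndAlg m F E}
    (h : s.Antihermitian ξ) :
    (LinearMap.toMatrixAlgEquiv b (ξ.1 x)).conjTranspose =
      -LinearMap.toMatrixAlgEquiv b (ξ.1 x) := by
  ext i j
  rw [Matrix.conjTranspose_apply, Matrix.neg_apply, toMatrix_eq_inner hb, toMatrix_eq_inner hb]
  refine (s.inner_conj x _ _).trans ?_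
  rw [h x, EndAlg.neg_apply, map_neg]

theorem Antihermitian.neg {ξ : EndAlg m F E} (h : s.Antihermitian ξ) : s.Antihermitian (-ξ) := by
  intro x u v
  have := h x u v
  simp only [neg_neg, EndAlg.neg_apply, map_neg, LinearMap.neg_apply] at this ⊢
  rw [this, neg_neg]

theorem Antihermitian.smul {ξ : EndAlg m F E} (h : s.Antihermitian ξ) (t : ℝ) :
    s.Antihermitian ((t : ℂ) • ξ) := by
  have := IsAdjoint.smul (t : ℂ) h
  rw [Complex.conj_ofReal, smul_neg] at this
  exact this

theorem isAdjoint_of_basis {S T : EndAlg m F E} (b : ∀ x, Module.Basis (Fin n) ℂ (E x))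
    (h : ∀ x i j, s.inner x (S.1 x (b x i)) (b x j) = s.inner x (b x i) (T.1 x (b x j))) :
    s.IsAdjoint S T := by
  intro x u v
  have h1 : ∀ i, s.inner x (S.1 x (b x i)) = s.inner x (b x i) ∘ₗ T.1 x := fun i =>
    (b x).ext fun j => h x i j
  have h2 : s.inner x v ∘ₗ S.1 x = s.inner x (T.1 x v) := (b x).ext fun i => by
    rw [LinearMap.comp_apply, ← s.inner_conj, h1, LinearMap.comp_apply, s.inner_conj]
  have h3 := congrArg (starRingEnd ℂ) (congrArg (fun A : E x →ₗ[ℂ] ℂ => A u) h2)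
  rwa [LinearMap.comp_apply, s.inner_conj, s.inner_conj] at h3

/-- In an orthonormal basis the adjoint is the conjugate transpose, which commutes with the
exponential. -/
theorem IsExpOf.isAdjoint (hn : 0 < n) (hF : Module.finrank ℂ F = n) {ξ U W : EndAlg m F E}
    (hξ : s.Antihermitian ξ) (hU : IsExpOf n ξ U) (hW : IsExpOf n (-ξ) W) : s.IsAdjoint U W := by
  choose b hb using s.exists_orthonormal hn hF
  refine isAdjoint_of_basis b fun x i j => ?_
  rw [hU x (b x), hW x (b x), ← toMatrix_eq_inner (hb x), toMatrix_expEnd, ← s.inner_conj,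
    ← toMatrix_eq_inner (hb x), toMatrix_expEnd]
  change star _ = _
  rw [← Matrix.conjTranspose_apply, ← Matrix.exp_conjTranspose, conjTranspose_toMatrix (hb x) hξ]
  exact congrArg (fun a : Matrix (Fin n) (Fin n) ℂ => NormedSpace.exp a i j)
    (map_neg (LinearMap.toMatrixAlgEquiv (b x)) (ξ.1 x)).symm

theorem IsExpOf.isGauge (hn : 0 < n) (hF : Module.finrank ℂ F = n) {ξ U W : EndAlg m F E}
    (hξ : s.Antihermitian ξ) (htr : ξ.Traceless) (hU : IsExpOf n ξ U) (hW : IsExpOf n (-ξ) W) :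
    s.IsGauge U := by
  intro x
  obtain ⟨b, hb⟩ := s.exists_orthonormal hn hF x
  refine ⟨fun u v => ?_, ?_⟩
  · rw [IsExpOf.isAdjoint hn hF hξ hU hW x]
    have hneg : IsExpOf n (- -ξ) U := by rwa [neg_neg]
    have := congrArg (fun S : EndAlg m F E => S.1 x v) (hW.mul_eq_one s hn hF hneg)
    rw [EndAlg.mul_apply, EndAlg.one_apply] at this
    rw [this]
  · rw [hU x b, expEnd]
    change LinearMap.det (Matrix.toLin b b _) = 1
    rw [LinearMap.det_toLin]
    refine det_exp_of_skewHermitian (conjTranspose_toMatrix hb hξ) ?_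
    exact (LinearMap.trace_eq_matrix_trace ℂ b (ξ.1 x)).symm.trans (htr x)

variable [IsManifold (𝓡 m) ∞ M] [T2Space M] [ContMDiffVectorBundle ∞ F E (𝓡 m)]

namespace Connection

/-- `W` is the inverse of `U`. The adjointness conditions preserve metric compatibility, the
determinants the parallel volume. -/
theorem exists_gaugeTransform (nab : s.Connection) (hn : 0 < n) (hF : Module.finrank ℂ F = n)
    {U W : EndAlg m F E} (hUW : U * W = 1) (hadj : s.IsAdjoint U W) (hadj' : s.IsAdjoint W U)
    (hdetU : ∀ x, LinearMap.det (U.1 x) = 1) (hdetW : ∀ x, LinearMap.det (W.1 x) = 1) :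
    ∃ nab' : s.Connection, ∀ X e, nab'.cov X e = U.act (nab.cov X (W.act e)) := by
  have hUWv : ∀ x v, U.1 x (W.1 x v) = v := fun x v =>
    congrArg (fun S : EndAlg m F E => S.1 x v) hUW
  refine ⟨⟨fun X e => U.act (nab.cov X (W.act e)), fun X Y e => ?_, fun f X Y hf h e x => ?_,
    fun X e e' => ?_, fun X f hf e x => ?_, fun X e e' x => ?_, fun X e x => ?_⟩, fun _ _ => rfl⟩
  · rw [nab.add_field, EndAlg.act_add_sec]
  · rw [EndAlg.act_apply, EndAlg.act_apply, nab.smul_field f X Y hf h, ← Complex.coe_smul,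
      map_smul, Complex.coe_smul]
  · rw [EndAlg.act_add_sec, nab.add_section, EndAlg.act_add_sec]
  · rw [EndAlg.act_fsmul, EndAlg.act_apply, nab.leibniz, map_add, map_smul, map_smul,
      EndAlg.act_apply, hUWv]
    rfl
  · have h := nab.metric X (W.act e) (W.act e') x
    have h1 : (fun y => s.inner y (W.act e y) (W.act e' y)) = fun y => s.inner y (e y) (e' y) :=
      funext fun y => by rw [EndAlg.act_apply, EndAlg.act_apply, hadj' y, hUWv]
    rw [h1] at h
    rw [h, EndAlg.act_apply, EndAlg.act_apply, EndAlg.act_apply, EndAlg.act_apply, hadj x,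
      ← hadj' x]
  · obtain ⟨b, -⟩ := s.exists_orthonormal hn hF x
    have h := nab.volume X (fun i => W.act (e i)) x
    have h1 : (fun y => s.vol y fun i => W.act (e i) y) = fun y => s.vol y fun i => e i y := by
      funext y
      obtain ⟨b, -⟩ := s.exists_orthonormal hn hF y
      have := topForm_comp b (s.vol y) (W.1 y) fun i => e i y
      rw [hdetW, one_mul] at this
      exact this
    rw [h1] at h
    rw [h]
    refine Finset.sum_congr rfl fun i _ => ?_
    have h2 := topForm_comp b (s.vol x) (U.1 x)
      (Function.update (fun j => W.act (e j) x) i (nab.cov X (W.act (e i)) x))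
    rw [hdetU, one_mul] at h2
    rw [← h2]
    congr 1
    funext j
    by_cases hj : j = i
    · subst hj; simp [EndAlg.act_apply]
    · simp [hj, EndAlg.act_apply, hUWv]

end Connection

end SUStructure

/-- The gauge transform of a noncommutative 1-form. -/
def gaugeForm {A : Type*} [Ring A] [Algebra ℂ A] (U W : A) (α : Form1 A) : Form1 A where
  toFun D := U * α D * W - D U * W
  map_add' D D' := by
    rw [map_add, Der.add_apply]
    noncomm_ring
  map_smul' z D := by
    rw [Form1.map_center_smul, Der.center_smul_apply, RingHom.id_apply, Subalgebra.smul_def,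
      smul_eq_mul, mul_sub, ← mul_assoc, ← center_comm z U]
    simp only [mul_assoc]

theorem gaugeForm_apply {A : Type*} [Ring A] [Algebra ℂ A] (U W : A) (α : Form1 A) (D : Der A) :
    gaugeForm U W α D = U * α D * W - D U * W := rfl

variable [IsManifold (𝓡 m) ∞ M] [T2Space M] [ContMDiffVectorBundle ∞ F E (𝓡 m)]

namespace SUStructure.Connection

variable {nab nab' : s.Connection} {α : Form1 (EndAlg m F E)} {U W : EndAlg m F E}

theorem covC_gauge (h : ∀ X e, nab'.cov X e = U.act (nab.cov X (W.act e))) (X Y : VectorField m M)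
    (e : Sec m F E) (x : M) : nab'.covC X Y e x = U.1 x (nab.covC X Y (W.act e) x) := by
  rw [covC, covC, h, h, map_add, map_smul]
  rfl

/-- Apply the decomposition of `D U` to the section `W e`; since `U W = 1`, the term `∇ (U W e)` is
`∇ e`. -/
theorem HasForm.gaugeForm_sub (hα : nab.HasForm α) (hn : 0 < n) (hF : Module.finrank ℂ F = n)
    (hUW : U * W = 1) {D : Der (EndAlg m F E)} {X Y : VectorField m M} (hXY : RestrictsTo D X Y)
    (e : Sec m F E) (x : M) :
    (gaugeForm U W α D - α D).1 x (e x) =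
      U.1 x (nab.covC X Y (W.act e) x) - nab.covC X Y e x := by
  have hUWv : ∀ x v, U.1 x (W.1 x v) = v := fun x v =>
    congrArg (fun S : EndAlg m F E => S.1 x v) hUW
  have h1 := hα.apply hXY hn hF U (W.act e) x
  rw [← EndAlg.act_mul, hUW, EndAlg.act_one] at h1
  rw [gaugeForm_apply]
  simp only [EndAlg.sub_apply, EndAlg.mul_apply, EndAlg.act_apply, hUWv] at h1 ⊢
  rw [h1]
  abel

theorem HasForm.gauge (hα : nab.HasForm α) (hn : 0 < n) (hF : Module.finrank ℂ F = n)
    (hUW : U * W = 1) (h : ∀ X e, nab'.cov X e = U.act (nab.cov X (W.act e))) :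
    nab'.HasForm (gaugeForm U W α) :=
  hα.of_covC hn hF fun D X Y hXY e x => by
    rw [hα.gaugeForm_sub hn hF hUW hXY, covC_gauge h]
    abel

end SUStructure.Connection

end Gauge

/-! ### Interchanging the derivative in `t` with a directional derivative -/

section Limits

variable {m : ℕ} {M : Type*} [TopologicalSpace M] [ChartedSpace (EuclideanSpace ℝ (Fin m)) M]
  [IsManifold (𝓡 m) ∞ M]

theorem tendsto_slope_comp_smul {V : Type*} [NormedAddCommGroup V] [NormedSpace ℝ V] {f : V → ℂ}
    (hf : ContDiff ℝ ∞ f) (v : V) :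
    Filter.Tendsto (fun t : ℝ => (t : ℂ)⁻¹ * (f (t • v) - f 0)) (𝓝[≠] 0)
      (𝓝 (fderiv ℝ f 0 v)) := by
  have h0 : HasFDerivAt f (fderiv ℝ f 0) ((0 : ℝ) • v) := by
    rw [zero_smul]
    exact (hf.differentiable (by simp) 0).hasFDerivAt
  have h1 := h0.comp_hasDerivAt (0 : ℝ) ((hasDerivAt_id (0 : ℝ)).smul_const v)
  rw [one_smul] at h1
  refine (hasDerivAt_iff_tendsto_slope_zero.1 h1).congr fun t => ?_
  simp only [Function.comp_apply, id, zero_add, zero_smul, Complex.real_smul, Complex.ofReal_inv]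

/-- By the product rule one term is an ordinary difference quotient of `f`. The other carries a
factor `t` from the chain rule, and the remaining `f' (t a)` converges by continuity. -/
theorem tendsto_dirDeriv_slope {V : Type*} [NormedAddCommGroup V] [NormedSpace ℝ V] {f : V → ℂ}
    (hf : ContDiff ℝ ∞ f) {a : M → V} {x : M} (ha : MDifferentiableAt (𝓡 m) 𝓘(ℝ, V) a x)
    {g : M → ℂ} (hg : IsDiffAt (m := m) g x) (X : VectorField m M) :
    Filter.Tendsto (fun t : ℝ => (t : ℂ)⁻¹ * (dirDeriv X (fun y => f (t • a y) * g y) x -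
        dirDeriv X (fun y => f 0 * g y) x)) (𝓝[≠] 0)
      (𝓝 (dirDeriv X (fun y => fderiv ℝ f 0 (a y) * g y) x)) := by
  let v : V := mfderiv (𝓡 m) 𝓘(ℝ, V) a x (X x)
  have hd : Differentiable ℝ f := hf.differentiable (by simp)
  have hd' : ∀ t : ℝ, Differentiable ℝ fun p : V => f (t • p) := fun t =>
    hd.comp (differentiable_id.const_smul t)
  have h1 : ∀ t : ℝ, dirDeriv X (fun y => f (t • a y) * g y) x =
      f (t • a x) * dirDeriv X g x + t * fderiv ℝ f (t • a x) v * g x := by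
    intro t
    rw [dirDeriv_mul X (f := fun y => f (t • a y)) (((hd' t).differentiableAt.mdifferentiableAt).comp x ha) hg,
      dirDeriv_comp X (f := fun p => f (t • p)) (hd' t).differentiableAt ha]
    have h2 : HasFDerivAt (fun p : V => f (t • p)) _ (a x) :=
      (hd (t • a x)).hasFDerivAt.comp (a x) ((hasFDerivAt_id (a x)).const_smul t)
    have h3 : fderiv ℝ (fun p : V => f (t • p)) (a x) v = t * fderiv ℝ f (t • a x) v := by
      rw [h2.fderiv, ← Complex.real_smul, ← map_smul]
      rfl
    rw [← h3]
  have h4 : dirDeriv X (fun y => fderiv ℝ f 0 (a y) * g y) x =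
      fderiv ℝ f 0 (a x) * dirDeriv X g x + fderiv ℝ f 0 v * g x := by
    rw [dirDeriv_mul X (f := fun y => fderiv ℝ f 0 (a y)) (((fderiv ℝ f 0).differentiableAt.mdifferentiableAt).comp x ha) hg,
      dirDeriv_clm_comp X (fderiv ℝ f 0) ha]
  rw [h4]
  have h5 : Filter.Tendsto (fun t : ℝ => fderiv ℝ f (t • a x) v) (𝓝[≠] 0)
      (𝓝 (fderiv ℝ f 0 v)) := by
    have hc : Continuous fun t : ℝ => fderiv ℝ f (t • a x) v :=
      ((hf.continuous_fderiv (by simp)).comp (continuous_id.smul continuous_const)).clm_apply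
        continuous_const
    have := hc.tendsto 0
    rw [zero_smul] at this
    exact this.mono_left nhdsWithin_le_nhds
  refine (((tendsto_slope_comp_smul hf (a x)).mul_const (dirDeriv X g x)).add
    (h5.mul_const (g x))).congr' ?_
  filter_upwards [self_mem_nhdsWithin] with t ht
  have ht' : (t : ℂ) ≠ 0 := Complex.ofReal_ne_zero.2 ht
  rw [h1, dirDeriv_const_mul X _ hg]
  field_simp
  ring

end Limits

/-! ### Differentiating the exponential and its covariant derivative at `t = 0` -/

section BundleLimits

variable {m : ℕ} {M : Type*} [TopologicalSpace M] [ChartedSpace (EuclideanSpace ℝ (Fin m)) M]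
  {F : Type*} [NormedAddCommGroup F] [NormedSpace ℂ F]
  {E : M → Type*} [∀ x, AddCommGroup (E x)] [∀ x, Module ℂ (E x)]
  [TopologicalSpace (TotalSpace F E)] [∀ x, TopologicalSpace (E x)] [FiberBundle F E]
  [VectorBundle ℂ F E] [VectorBundle ℝ F E]
  {n : ℕ} {s : SUStructure m F E n}
  [IsManifold (𝓡 m) ∞ M] [T2Space M] [ContMDiffVectorBundle ∞ F E (𝓡 m)]

namespace SUStructure

theorem tendsto_inner_exp (s : SUStructure m F E n) (hn : 0 < n) (hF : Module.finrank ℂ F = n)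
    {ξ : EndAlg m F E} {U : ℝ → EndAlg m F E} (hU : ∀ t : ℝ, IsExpOf n ((t : ℂ) • ξ) (U t))
    {x : M} (w v : E x) :
    Filter.Tendsto (fun t : ℝ => (t : ℂ)⁻¹ * (s.inner x w ((U t).1 x v) - s.inner x w v))
      (𝓝[≠] 0) (𝓝 (s.inner x w (ξ.1 x v))) := by
  obtain ⟨b, -⟩ := s.exists_orthonormal hn hF x
  let a : Fin n → Fin n → ℂ := fun i j => b.repr (ξ.1 x (b j)) i
  have h1 := tendsto_finsetSum Finset.univ fun i _ => tendsto_finsetSum Finset.univ fun j _ =>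
    (tendsto_slope_comp_smul (contDiff_entryExp i j) a).mul_const
      (b.repr v j * s.inner x w (b i))
  have hUt : ∀ t, s.inner x w ((U t).1 x v) =
      ∑ i, ∑ j, entryExp i j (t • a) * (b.repr v j * s.inner x w (b i)) := by
    intro t
    rw [hU t x b, expEnd_apply, map_sum]
    refine Finset.sum_congr rfl fun i _ => ?_
    rw [map_sum]
    refine Finset.sum_congr rfl fun j _ => ?_
    rw [map_smul, smul_eq_mul, mul_assoc]
    congr 2
    funext i j
    change b.repr ((t : ℂ) • ξ.1 x (b j)) i = t • b.repr (ξ.1 x (b j)) i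
    rw [map_smul, Complex.real_smul]
    rfl
  have hv : s.inner x w v = ∑ i, ∑ j, entryExp i j 0 * (b.repr v j * s.inner x w (b i)) := by
    simp only [entryExp_zero, ite_mul, one_mul, zero_mul, Finset.sum_ite_eq, Finset.mem_univ,
      if_true]
    conv_lhs => rw [← b.sum_repr v, map_sum]
    exact Finset.sum_congr rfl fun i _ => by rw [map_smul, smul_eq_mul]
  have hξ : s.inner x w (ξ.1 x v) =
      ∑ i, ∑ j, fderiv ℝ (entryExp i j) 0 a * (b.repr v j * s.inner x w (b i)) := by
    rw [sum_repr_smul b, map_sum]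
    refine Finset.sum_congr rfl fun i _ => ?_
    rw [map_sum]
    refine Finset.sum_congr rfl fun j _ => ?_
    rw [map_smul, smul_eq_mul, mul_assoc, fderiv_entryExp_zero]
  rw [hξ]
  refine h1.congr fun t => ?_
  rw [hUt, hv, ← Finset.sum_sub_distrib, Finset.mul_sum]
  refine Finset.sum_congr rfl fun i _ => ?_
  rw [← Finset.sum_sub_distrib, Finset.mul_sum]
  refine Finset.sum_congr rfl fun j _ => ?_
  ring

theorem tendsto_dirDeriv_inner_exp (s : SUStructure m F E n) (hn : 0 < n)
    (hF : Module.finrank ℂ F = n) {ξ : EndAlg m F E} {U : ℝ → EndAlg m F E}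
    (hU : ∀ t : ℝ, IsExpOf n ((t : ℂ) • ξ) (U t)) (X : VectorField m M) (w y : Sec m F E) (x : M) :
    Filter.Tendsto (fun t : ℝ => (t : ℂ)⁻¹ *
        (dirDeriv X (fun z => s.inner z (w z) ((U t).act y z)) x -
          dirDeriv X (fun z => s.inner z (w z) (y z)) x))
      (𝓝[≠] 0) (𝓝 (dirDeriv X (fun z => s.inner z (w z) (ξ.act y z)) x)) := by
  obtain ⟨-, e, -, -, hvol⟩ := s.exists_frame hn hF x
  let a := s.coordMatrix e ξ
  let g : Fin n → Fin n → M → ℂ := fun i j z => s.coord e j y z * s.inner z (w z) (e i z)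
  have ha : MDifferentiableAt (𝓡 m) 𝓘(ℝ, Fin n → Fin n → ℂ) a x :=
    (contMDiffAt_coordMatrix hvol ξ).mdifferentiableAt (by simp)
  have hg : ∀ i j, IsDiffAt (m := m) (g i j) x := fun i j =>
    (contMDiffAt_mul (contMDiffAt_coord hvol j y)
      (s.inner_smooth w (e i) x)).mdifferentiableAt (by simp)
  have h1 := tendsto_finsetSum Finset.univ fun i _ => tendsto_finsetSum Finset.univ fun j _ =>
    tendsto_dirDeriv_slope (contDiff_entryExp i j) ha (hg i j) X
  -- Directional derivatives are local, so expansions in the frame are only needed where its volume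
  -- is nonzero.
  have hsum : ∀ (c : Fin n → Fin n → M → ℂ), (∀ i j, IsDiffAt (m := m) (c i j) x) → ∀ f : M → ℂ,
      (∀ z, (s.vol z fun i => e i z) ≠ 0 → f z = ∑ i, ∑ j, c i j z * g i j z) →
      dirDeriv X f x = ∑ i, ∑ j, dirDeriv X (fun z => c i j z * g i j z) x := by
    intro c hc f hf
    have h2 : f =ᶠ[𝓝 x] fun z => ∑ i, ∑ j, c i j z * g i j z := by
      filter_upwards [eventually_vol_ne_zero hvol] with z hz using hf z hz
    have h3 : ∀ i j, IsDiffAt (m := m) (fun z => c i j z * g i j z) x := fun i j =>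
      (contDiff_mul (𝕜 := ℝ) (𝔸 := ℂ) (n := ∞)).differentiable (by simp) |>.differentiableAt
        |>.mdifferentiableAt.comp x ((hc i j).prodMk_space (hg i j))
    rw [dirDeriv_congr X h2,
      (dirDeriv_sum _ X fun i => (dirDeriv_sum Finset.univ X fun j => h3 i j).1).2]
    exact Finset.sum_congr rfl fun i _ => (dirDeriv_sum Finset.univ X fun j => h3 i j).2
  have hUt : ∀ t, dirDeriv X (fun z => s.inner z (w z) ((U t).act y z)) x =
      ∑ i, ∑ j, dirDeriv X (fun z => entryExp i j (t • a z) * g i j z) x := by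
    intro t
    refine hsum (fun i j z => entryExp i j (t • a z)) (fun i j => ?_) _ fun z hz => ?_
    · exact (((contDiff_entryExp i j).differentiable (by simp)).comp
        (differentiable_id.const_smul t)).differentiableAt.mdifferentiableAt.comp x ha
    · obtain ⟨b, hb, hr⟩ := s.exists_basis_of_frame hn hF hz
      rw [EndAlg.act_apply, hU t z b, expEnd_apply, map_sum]
      refine Finset.sum_congr rfl fun i _ => ?_
      rw [map_sum]
      refine Finset.sum_congr rfl fun j _ => ?_
      rw [map_smul, smul_eq_mul, mul_assoc, hr, hb]
      congr 2
      funext i j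
      change b.repr ((t : ℂ) • ξ.1 z (b j)) i = t • s.coord e i (ξ.act (e j)) z
      rw [map_smul, Complex.real_smul, ← hr, hb]
      rfl
  have hv : dirDeriv X (fun z => s.inner z (w z) (y z)) x =
      ∑ i, ∑ j, dirDeriv X (fun z => entryExp i j 0 * g i j z) x := by
    refine hsum (fun i j _ => entryExp i j 0) (fun i j => mdifferentiableAt_const) _ fun z hz => ?_
    obtain ⟨b, hb, hr⟩ := s.exists_basis_of_frame hn hF hz
    simp only [entryExp_zero, ite_mul, one_mul, zero_mul, Finset.sum_ite_eq, Finset.mem_univ,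
      if_true]
    conv_lhs => rw [← b.sum_repr (y z), map_sum]
    exact Finset.sum_congr rfl fun i _ => by rw [map_smul, smul_eq_mul, hr, hb]
  have hξ : dirDeriv X (fun z => s.inner z (w z) (ξ.act y z)) x =
      ∑ i, ∑ j, dirDeriv X (fun z => fderiv ℝ (entryExp i j) 0 (a z) * g i j z) x := by
    refine hsum (fun i j z => fderiv ℝ (entryExp i j) 0 (a z)) (fun i j => ?_) _ fun z hz => ?_
    · exact (fderiv ℝ (entryExp i j) 0).differentiableAt.mdifferentiableAt.comp x ha
    · obtain ⟨b, hb, hr⟩ := s.exists_basis_of_frame hn hF hz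
      rw [EndAlg.act_apply, sum_repr_smul b, map_sum]
      refine Finset.sum_congr rfl fun i _ => ?_
      rw [map_sum]
      refine Finset.sum_congr rfl fun j _ => ?_
      rw [map_smul, smul_eq_mul, mul_assoc, fderiv_entryExp_zero, hr y, hb i, hb j,
        ← EndAlg.act_apply, hr]
      rfl
  rw [hξ]
  refine h1.congr fun t => ?_
  rw [hUt, hv, ← Finset.sum_sub_distrib, Finset.mul_sum]
  refine Finset.sum_congr rfl fun i _ => ?_
  rw [← Finset.sum_sub_distrib, Finset.mul_sum]

namespace Connection

variable (nab : s.Connection)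

/-- Metric compatibility, `⟨w, ∇ z⟩ = X⟨w, z⟩ - ⟨∇ w, z⟩`, reduces the limit to derivatives of
scalar functions. -/
theorem tendsto_inner_cov_exp (hn : 0 < n) (hF : Module.finrank ℂ F = n) {ξ : EndAlg m F E}
    {U : ℝ → EndAlg m F E} (hU : ∀ t : ℝ, IsExpOf n ((t : ℂ) • ξ) (U t)) (X : VectorField m M)
    (y : Sec m F E) {x : M} (w : E x) :
    Filter.Tendsto (fun t : ℝ => (t : ℂ)⁻¹ *
        (s.inner x w (nab.cov X ((U t).act y) x) - s.inner x w (nab.cov X y x)))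
      (𝓝[≠] 0) (𝓝 (s.inner x w (nab.cov X (ξ.act y) x))) := by
  obtain ⟨w, rfl⟩ := exists_section (m := m) (F := F) w
  have h : ∀ z : Sec m F E, s.inner x (w x) (nab.cov X z x) =
      dirDeriv X (fun p => s.inner p (w p) (z p)) x - s.inner x (nab.cov X w x) (z x) := fun z => by
    rw [nab.metric]; ring
  rw [h (ξ.act y)]
  refine ((s.tendsto_dirDeriv_inner_exp hn hF hU X w y x).sub
    (s.tendsto_inner_exp hn hF hU (nab.cov X w x) (y x))).congr fun t => ?_
  rw [h, h]
  simp only [EndAlg.act_apply]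
  ring

theorem tendsto_inner_covC_exp (hn : 0 < n) (hF : Module.finrank ℂ F = n) {ξ : EndAlg m F E}
    {U : ℝ → EndAlg m F E} (hU : ∀ t : ℝ, IsExpOf n ((t : ℂ) • ξ) (U t)) (X Y : VectorField m M)
    (y : Sec m F E) {x : M} (w : E x) :
    Filter.Tendsto (fun t : ℝ => (t : ℂ)⁻¹ *
        (s.inner x w (nab.covC X Y ((U t).act y) x) - s.inner x w (nab.covC X Y y x)))
      (𝓝[≠] 0) (𝓝 (s.inner x w (nab.covC X Y (ξ.act y) x))) := by
  simp only [covC, map_add, map_smul, smul_eq_mul]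
  refine ((nab.tendsto_inner_cov_exp hn hF hU X y w).add
    ((nab.tendsto_inner_cov_exp hn hF hU Y y w).const_mul Complex.I)).congr fun t => ?_
  ring

/-- The derivative of a gauge transform of a connection along a one parameter group. -/
theorem tendsto_gauge (hn : 0 < n) (hF : Module.finrank ℂ F = n) {ξ : EndAlg m F E}
    {U W : ℝ → EndAlg m F E} (hU : ∀ t : ℝ, IsExpOf n ((t : ℂ) • ξ) (U t))
    (hW : ∀ t : ℝ, IsExpOf n ((t : ℂ) • -ξ) (W t)) (X Y : VectorField m M)
    (y : Sec m F E) (x : M) :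
    Filter.Tendsto (fun t : ℝ => (t : ℂ)⁻¹ •
        ((U t).1 x (nab.covC X Y ((W t).act y) x) - nab.covC X Y y x))
      (𝓝[≠] 0) (𝓝 (ξ.1 x (nab.covC X Y y x) - nab.covC X Y (ξ.act y) x)) := by
  obtain ⟨b, hb⟩ := s.exists_orthonormal hn hF x
  refine tendsto_of_repr (F := F) b fun i => ?_
  simp only [repr_eq_inner hb]
  let Z := nab.covC X Y y x
  have hneg : nab.covC X Y ((-ξ).act y) x = -nab.covC X Y (ξ.act y) x := by
    have h1 := nab.covC_add_section X Y ((-ξ).act y) (ξ.act y) x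
    have h2 : (-ξ).act y + ξ.act y = 0 := ContMDiffSection.ext fun z => neg_add_cancel (ξ.1 z (y z))
    have h3 : nab.covC X Y 0 x = 0 := by
      have := nab.covC_add_section X Y 0 0 x
      rwa [add_zero, left_eq_add] at this
    rw [h2, h3] at h1
    exact eq_neg_of_add_eq_zero_left h1.symm
  have hU0 : ∀ j, Filter.Tendsto (fun t : ℝ => s.inner x (b i) ((U t).1 x (b j))) (𝓝[≠] 0)
      (𝓝 (s.inner x (b i) (b j))) := by
    intro j
    have h1 := s.tendsto_inner_exp hn hF hU (b i) (b j)
    have h2 : Filter.Tendsto (fun t : ℝ => (t : ℂ)) (𝓝[≠] 0) (𝓝 0) := by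
      have := Complex.continuous_ofReal.tendsto 0
      rw [Complex.ofReal_zero] at this
      exact this.mono_left nhdsWithin_le_nhds
    have h3 := (h2.mul h1).add_const (s.inner x (b i) (b j))
    rw [zero_mul, zero_add] at h3
    refine h3.congr' ?_
    filter_upwards [self_mem_nhdsWithin] with t ht
    have ht' : (t : ℂ) ≠ 0 := Complex.ofReal_ne_zero.2 ht
    field_simp
    ring
  -- Split `U (∇ (W y)) - ∇ y` as `U (∇ (W y) - ∇ y) + (U Z - Z)` with `Z = ∇ y`; the first part
  -- uses `U → 1`.
  have h1 := tendsto_finsetSum Finset.univ fun j _ =>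
    (hU0 j).mul (nab.tendsto_inner_covC_exp hn hF hW X Y y (b j))
  have h2 := h1.add (s.tendsto_inner_exp hn hF hU (b i) Z)
  have h3 : ∑ j, s.inner x (b i) (b j) * s.inner x (b j) (nab.covC X Y ((-ξ).act y) x) +
      s.inner x (b i) (ξ.1 x Z) =
      s.inner x (b i) (ξ.1 x (nab.covC X Y y x) - nab.covC X Y (ξ.act y) x) := by
    simp only [hb, ite_mul, one_mul, zero_mul, Finset.sum_ite_eq, Finset.mem_univ, if_true, hneg,
      map_neg, map_sub, Z]
    ring
  rw [h3] at h2
  refine h2.congr fun t => ?_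
  have h4 : ∀ u : E x, s.inner x (b i) ((U t).1 x u) =
      ∑ j, s.inner x (b i) ((U t).1 x (b j)) * s.inner x (b j) u := by
    intro u
    conv_lhs => rw [← b.sum_repr u, map_sum, map_sum]
    refine Finset.sum_congr rfl fun j _ => ?_
    rw [map_smul, map_smul, repr_eq_inner hb, smul_eq_mul, mul_comm]
  rw [map_smul, map_sub, smul_eq_mul, h4 (nab.covC X Y ((W t).act y) x), h4 Z]
  simp only [Finset.mul_sum, mul_sub, Finset.sum_sub_distrib]
  have h5 : ∀ p q : ℂ, p * ((t : ℂ)⁻¹ * q) = (t : ℂ)⁻¹ * (p * q) := fun p q => by ring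
  simp only [h5, Z]
  ring

end Connection

end SUStructure

end BundleLimits

/-! ### The Lie derivative along `ad ξ` as an infinitesimal gauge transformation -/

section GaugeFlow

variable {m : ℕ} {M : Type*} [TopologicalSpace M] [ChartedSpace (EuclideanSpace ℝ (Fin m)) M]
  {F : Type*} [NormedAddCommGroup F] [NormedSpace ℂ F]
  {E : M → Type*} [∀ x, AddCommGroup (E x)] [∀ x, Module ℂ (E x)]
  [TopologicalSpace (TotalSpace F E)] [∀ x, TopologicalSpace (E x)] [FiberBundle F E]
  [VectorBundle ℂ F E] [VectorBundle ℝ F E]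
  {n : ℕ} {s : SUStructure m F E n}
  [IsManifold (𝓡 m) ∞ M] [T2Space M] [ContMDiffVectorBundle ∞ F E (𝓡 m)]

namespace SUStructure.Connection

variable {nab : s.Connection} {α : Form1 (EndAlg m F E)} {ξ : EndAlg m F E}

theorem HasForm.lieDeriv_ad_apply (hα : nab.HasForm α) (hn : 0 < n)
    (hF : Module.finrank ℂ F = n) (htr : ξ.Traceless) (D : Der (EndAlg m F E)) :
    lieDeriv (ad ξ) α D = -(d0 ξ D) - (α D * ξ - ξ * α D) := by
  have h1 : ⁅ad ξ, D⁆ = -ad (D ξ) := by rw [← lie_skew, lie_ad]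
  rw [lieDeriv_apply, h1, map_neg, hα.on_inner hn hF (hα.traceless_apply hn hF D htr), ad_apply]
  change _ = -(D ξ) - _
  abel

/-- The Lie derivative along `ad ξ` is the derivative of the gauge transforms by `exp (t ξ)`. -/
theorem HasForm.exists_gauge_flow (hα : nab.HasForm α) (hn : 0 < n)
    (hF : Module.finrank ℂ F = n) (htr : ξ.Traceless) (hξ : s.Antihermitian ξ) :
    ∃ (U : ℝ → EndAlg m F E) (nabU : ℝ → s.Connection) (αU : ℝ → Form1 (EndAlg m F E)),
      (∀ t, IsExp t ξ (U t) ∧ s.IsGauge (U t) ∧ IsGaugeTransform (U t) nab (nabU t) ∧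
        (nabU t).HasForm (αU t)) ∧
      ∀ (D : Der (EndAlg m F E)) (x : M) (v : E x),
        Filter.Tendsto (fun t : ℝ => (t : ℂ)⁻¹ • ((αU t D).1 x v - (α D).1 x v)) (𝓝[≠] 0)
          (𝓝 ((lieDeriv (ad ξ) α D).1 x v)) := by
  choose U hU using fun t : ℝ => s.exists_isExpOf hn hF ((t : ℂ) • ξ)
  choose W hW using fun t : ℝ => s.exists_isExpOf hn hF ((t : ℂ) • -ξ)
  have hW' : ∀ t : ℝ, IsExpOf n (-((t : ℂ) • ξ)) (W t) := fun t => by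
    rw [← smul_neg]; exact hW t
  have hU' : ∀ t : ℝ, IsExpOf n (-((t : ℂ) • -ξ)) (U t) := fun t => by
    rw [smul_neg, neg_neg]; exact hU t
  have hUW : ∀ t, U t * W t = 1 := fun t => (hU t).mul_eq_one s hn hF (hW' t)
  have hWU : ∀ t, W t * U t = 1 := fun t => (hW t).mul_eq_one s hn hF (hU' t)
  have hgU : ∀ t, s.IsGauge (U t) := fun t =>
    IsExpOf.isGauge hn hF (hξ.smul t) (htr.smul _) (hU t) (hW' t)
  have hgW : ∀ t, s.IsGauge (W t) := fun t =>
    IsExpOf.isGauge hn hF (hξ.neg.smul t) (htr.neg.smul _) (hW t) (hU' t)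
  choose nabU hnab using fun t => nab.exists_gaugeTransform hn hF (hUW t)
    (IsExpOf.isAdjoint hn hF (hξ.smul t) (hU t) (hW' t))
    (IsExpOf.isAdjoint hn hF (hξ.neg.smul t) (hW t) (hU' t))
    (fun x => (hgU t x).2) (fun x => (hgW t x).2)
  refine ⟨U, nabU, fun t => gaugeForm (U t) (W t) α, fun t => ⟨(hU t).isExp s hn hF, hgU t,
    fun X e => ?_, hα.gauge hn hF (hUW t) (hnab t)⟩, fun D x v => ?_⟩
  · rw [hnab, ← EndAlg.act_mul, hWU, EndAlg.act_one]
  · obtain ⟨e, rfl⟩ := exists_section (m := m) (F := F) v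
    obtain ⟨-, X, Y, hXY, H⟩ := hα D
    have h1 := nab.tendsto_gauge hn hF hU hW X Y e x
    have h2 : (lieDeriv (ad ξ) α D).1 x (e x) =
        ξ.1 x (nab.covC X Y e x) - nab.covC X Y (ξ.act e) x := by
      rw [hα.lieDeriv_ad_apply hn hF htr]
      change -(D ξ).1 x (e x) - (α D * ξ - ξ * α D).1 x (e x) = _
      rw [H]
      abel
    rw [h2]
    -- The difference of forms is `U ∇ U⁻¹ - ∇` along the vector field of `D`, whose difference
    -- quotient is already known.
    refine h1.congr fun t => ?_
    rw [← hα.gaugeForm_sub hn hF (hUW t) hXY]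
    rfl

end SUStructure.Connection

end GaugeFlow

end NC

end

theorem mainTheorem6 {m n : ℕ} (hn : 0 < n)
    {M : Type*} [TopologicalSpace M] [T2Space M] [ParacompactSpace M]
    [ChartedSpace (EuclideanSpace ℝ (Fin m)) M] [IsManifold (𝓡 m) ∞ M]
    {F : Type*} [NormedAddCommGroup F] [NormedSpace ℂ F] (hF : Module.finrank ℂ F = n)
    {E : M → Type*} [∀ x, AddCommGroup (E x)] [∀ x, Module ℂ (E x)]
    [TopologicalSpace (TotalSpace F E)] [∀ x, TopologicalSpace (E x)] [FiberBundle F E]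
    [VectorBundle ℂ F E] [VectorBundle ℝ F E] [ContMDiffVectorBundle ∞ F E (𝓡 m)]
    (s : NC.SUStructure m F E n) :
    -- the real derivations form a real Lie algebra
    ((∀ D D' : NC.Der (NC.EndAlg m F E), s.IsReal D → s.IsReal D' → s.IsReal ⁅D, D'⁆) ∧
      (∀ (a b : ℝ) (D D' : NC.Der (NC.EndAlg m F E)), s.IsReal D → s.IsReal D' →
        s.IsReal ((a : ℂ) • D + (b : ℂ) • D'))) ∧
    -- which acts linearly on the noncommutative 1-forms by the Lie derivative
    ((∀ (D D' : NC.Der (NC.EndAlg m F E)) (β : NC.Form1 (NC.EndAlg m F E)),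
        NC.lieDeriv ⁅D, D'⁆ β =
          NC.lieDeriv D (NC.lieDeriv D' β) - NC.lieDeriv D' (NC.lieDeriv D β)) ∧
      (∀ (a b : ℝ) (D D' : NC.Der (NC.EndAlg m F E)) (β : NC.Form1 (NC.EndAlg m F E)),
        NC.lieDeriv ((a : ℂ) • D + (b : ℂ) • D') β =
          (a : ℂ) • NC.lieDeriv D β + (b : ℂ) • NC.lieDeriv D' β) ∧
      (∀ (a b : ℝ) (D : NC.Der (NC.EndAlg m F E)) (β β' : NC.Form1 (NC.EndAlg m F E)),
        NC.lieDeriv D ((a : ℂ) • β + (b : ℂ) • β') =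
          (a : ℂ) • NC.lieDeriv D β + (b : ℂ) • NC.lieDeriv D β')) ∧
    -- and thereby on the space of connections
    (∀ (nab : s.Connection) (α : NC.Form1 (NC.EndAlg m F E)), nab.HasForm α →
      ∀ D : NC.Der (NC.EndAlg m F E), s.IsReal D →
        (∀ γ : NC.EndAlg m F E, γ.Traceless → NC.lieDeriv D α (NC.ad γ) = 0) ∧
        (∀ D' : NC.Der (NC.EndAlg m F E), (NC.lieDeriv D α D').Traceless) ∧
        (∀ D' : NC.Der (NC.EndAlg m F E), s.IsReal D' →
          s.Antihermitian (NC.lieDeriv D α D')) ∧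
        s.IsSUForm (α + NC.lieDeriv D α) ∧
        ∃! nab' : s.Connection, nab'.HasForm (α + NC.lieDeriv D α)) ∧
    -- inner real derivations are the `ad ξ` with `ξ` in the Lie algebra of the gauge group
    (∀ ξ : NC.EndAlg m F E, ξ.Traceless → s.Antihermitian ξ → s.IsReal (NC.ad ξ)) ∧
    (∀ η : NC.EndAlg m F E, s.IsReal (NC.ad η) →
      ∃! ξ : NC.EndAlg m F E, ξ.Traceless ∧ s.Antihermitian ξ ∧ NC.ad ξ = NC.ad η) ∧
    -- and their Lie derivatives are the infinitesimal gauge transformations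
    (∀ ξ : NC.EndAlg m F E, ξ.Traceless → s.Antihermitian ξ →
      ∀ (nab : s.Connection) (α : NC.Form1 (NC.EndAlg m F E)), nab.HasForm α →
        (∀ D : NC.Der (NC.EndAlg m F E),
          NC.lieDeriv (NC.ad ξ) α D = -(NC.d0 ξ D) - (α D * ξ - ξ * α D)) ∧
        ∃ (U : ℝ → NC.EndAlg m F E) (nabU : ℝ → s.Connection)
          (αU : ℝ → NC.Form1 (NC.EndAlg m F E)),
          (∀ t, NC.IsExp t ξ (U t) ∧ s.IsGauge (U t) ∧
            NC.SUStructure.Connection.IsGaugeTransform (U t) nab (nabU t) ∧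
            (nabU t).HasForm (αU t)) ∧
          ∀ (D : NC.Der (NC.EndAlg m F E)) (x : M) (v : E x),
            Filter.Tendsto
              (fun t : ℝ => (t : ℂ)⁻¹ • ((αU t D).1 x v - (α D).1 x v)) (𝓝[≠] 0)
              (𝓝 ((NC.lieDeriv (NC.ad ξ) α D).1 x v))) := by
  refine ⟨⟨fun D D' hD hD' => hD.lie hD', fun a b D D' hD hD' => (hD.smul a).add (hD'.smul b)⟩,
    ⟨NC.lieDeriv_lie, fun a b => NC.lieDeriv_add_smul_left (a : ℂ) (b : ℂ),
      fun a b => NC.lieDeriv_add_smul_right (a : ℂ) (b : ℂ)⟩,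
    fun nab α hα D hD => ⟨fun γ hγ => hα.lieDeriv_ad hn hF D hγ,
      fun D' => hα.lieDeriv_traceless hn hF D D',
      fun D' hD' => hα.lieDeriv_antihermitian hn hF hD hD',
      hα.isSUForm_add_lieDeriv hn hF hD,
      hα.existsUnique hn hF (hα.isSUForm_add_lieDeriv hn hF hD)⟩,
    fun ξ _ hξ => NC.SUStructure.isReal_ad hξ,
    fun η hη => NC.SUStructure.existsUnique_traceless hn hF hη,
    fun ξ htr hξ nab α hα => ⟨fun D => hα.lieDeriv_ad_apply hn hF htr D, ?_⟩⟩
  exact hα.exists_gauge_flow hn hF htr hξ
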